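/- Let $R$ be a commutative ring with unity and let $C$ be a semidualizing $R$-module, that is: $C$ has a resolution by finitely generated projective $R$-modules, the homothety map $R\to\operatorname{Hom}_R(C,C)$ is an isomorphism, and $\operatorname{Ext}^i_R(C,C)=0$ for all $i\ge 1$. An $R$-module $M$ is called $G_C$-projective if there is an exact sequence of $R$-modules $$\mathbb X=\ \cdots\to P_1\to P_0\to C\otimes_R P_{-1}\to C\otimes_R P_{-2}\to\cdots$$ with all $P_i$ projective, such that $M\cong\operatorname{im}(P_0\to C\otimes_R P_{-1})$ and $\operatorname{Hom}_R(\mathbb X,C\otimes_R P)$ is exact for every projective $R$-module $P$. An $R$-module $M$ is called $G_C$-flat if there is an exact sequence of $R$-modules $$\mathbb Y=\ \cdots\to F_1\to F_0\to C\otimes_R F_{-1}\to C\otimes_R F_{-2}\to\cdots$$ with all $F_i$ flat, such that $M\cong\operatorname{im}(F_0\to C\otimes_R F_{-1})$ and $\operatorname{Hom}_R(C,I)\otimes_R\mathbb Y$ is exact for every injective $R$-module $I$. The $G_C$-flat dimension $G_C\text{-}\mathrm{fd}_R(M)$ is the infimum, over all exact sequences $\cdots\to X_1\to X_0\to M\to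 0$ with all $X_n$ $G_C$-flat, of $\sup\{n\ge 0\mid X_n\ne 0\}$, and the $C$-Gorenstein weak global dimension of $R$ is $G_C\text{-}w\mathrm{gldim}(R)=\sup\{G_C\text{-}\mathrm{fd}_R(M)\mid M \text{ an } R\text{-module}\}$. The ring $R$ is called $G_C$-semihereditary if $R$ is coherent and every submodule of a flat $R$-module is $G_C$-flat. **Theorem.** Suppose that $G_C\text{-}w\mathrm{gldim}(R)<\infty$. If every finitely generated submodule of a $G_C$-projective $R$-module is $G_C$-projective, then $R$ is $G_C$-semihereditary. -/

import Mathlib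

open TensorProduct

universe u

namespace GCModules

/-- A sequence of modules and linear maps, infinite in both directions,
`⋯ → left 1 → left 0 → right 0 → right 1 → ⋯`. -/
structure TwoSidedSeq (R : Type u) [CommRing R] where
  left : ℕ → ModuleCat.{u} R
  right : ℕ → ModuleCat.{u} R
  dLeft (n : ℕ) : left (n + 1) →ₗ[R] left n
  mid : left 0 →ₗ[R] right 0
  dRight (n : ℕ) : right n →ₗ[R] right (n + 1)

namespace TwoSidedSeq

variable {R : Type u} [CommRing R]

/-- The sequence is exact at every term. -/
structure IsExact (X : TwoSidedSeq R) : Prop where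
  left (n : ℕ) : Function.Exact (X.dLeft (n + 1)) (X.dLeft n)
  left_mid : Function.Exact (X.dLeft 0) X.mid
  mid_right : Function.Exact X.mid (X.dRight 0)
  right (n : ℕ) : Function.Exact (X.dRight n) (X.dRight (n + 1))

/-- The sequence `Hom_R(X, W)`, with maps given by precomposition, is exact at every term. -/
structure IsHomExact (X : TwoSidedSeq R) (W : Type u) [AddCommGroup W] [Module R W] : Prop where
  left (n : ℕ) : Function.Exact ((X.dLeft n).lcomp R W) ((X.dLeft (n + 1)).lcomp R W)
  left_mid : Function.Exact (X.mid.lcomp R W) ((X.dLeft 0).lcomp R W)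
  mid_right : Function.Exact ((X.dRight 0).lcomp R W) (X.mid.lcomp R W)
  right (n : ℕ) : Function.Exact ((X.dRight (n + 1)).lcomp R W) ((X.dRight n).lcomp R W)

/-- The sequence `J ⊗_R X` is exact at every term. -/
structure IsTensorExact (X : TwoSidedSeq R) (J : Type u) [AddCommGroup J] [Module R J] :
    Prop where
  left (n : ℕ) : Function.Exact ((X.dLeft (n + 1)).lTensor J) ((X.dLeft n).lTensor J)
  left_mid : Function.Exact ((X.dLeft 0).lTensor J) (X.mid.lTensor J)
  mid_right : Function.Exact (X.mid.lTensor J) ((X.dRight 0).lTensor J)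
  right (n : ℕ) : Function.Exact ((X.dRight n).lTensor J) ((X.dRight (n + 1)).lTensor J)

end TwoSidedSeq

/-- An exact sequence `⋯ → obj 1 → obj 0 → M → 0`. -/
structure LeftResolution (R : Type u) [CommRing R] (M : Type u) [AddCommGroup M]
    [Module R M] where
  obj : ℕ → ModuleCat.{u} R
  d (n : ℕ) : obj (n + 1) →ₗ[R] obj n
  ε : obj 0 →ₗ[R] M
  exact_d (n : ℕ) : Function.Exact (d (n + 1)) (d n)
  exact_ε : Function.Exact (d 0) ε
  surjective_ε : Function.Surjective ε

/-- The length `sup {n ≥ 0 | obj n ≠ 0}` of a resolution. -/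
noncomputable def LeftResolution.length {R : Type u} [CommRing R] {M : Type u} [AddCommGroup M]
    [Module R M] (X : LeftResolution R M) : ℕ∞ :=
  ⨆ (n : ℕ) (_ : Nontrivial (X.obj n)), (n : ℕ∞)

/-- For a class `𝒳` of modules, the `𝒳`-projective dimension of `M`: the infimum of the lengths
of the resolutions of `M` by modules of `𝒳` (it is `⊤` if there is none of finite length). -/
noncomputable def relProjDim {R : Type u} [CommRing R] (𝒳 : ModuleCat.{u} R → Prop)
    (M : Type u) [AddCommGroup M] [Module R M] : ℕ∞ :=
  ⨅ (X : LeftResolution R M) (_ : ∀ n, 𝒳 (X.obj n)), X.length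

/-- Semidualizing modules. -/
structure IsSemidualizing (R : Type u) [CommRing R] (C : Type u) [AddCommGroup C]
    [Module R C] : Prop where
  /-- `C` has a resolution by finitely generated projective modules. -/
  exists_resolution : ∃ X : LeftResolution R C,
    ∀ n, Module.Finite R (X.obj n) ∧ Module.Projective R (X.obj n)
  /-- The homothety map `R → Hom_R(C, C)` is an isomorphism. -/
  bijective_homothety : Function.Bijective (LinearMap.lsmul R C)
  /-- `Ext^i_R(C, C) = 0` for `i ≥ 1`. -/
  ext_eq_zero (i : ℕ) (hi : 1 ≤ i) :
    Subsingleton (CategoryTheory.Abelian.Ext (ModuleCat.of R C) (ModuleCat.of R C) i)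

section

variable (R : Type u) [CommRing R] (C : Type u) [AddCommGroup C] [Module R C]

/-- `G_C`-projective modules. -/
def IsGCProjective (M : Type u) [AddCommGroup M] [Module R M] : Prop :=
  ∃ X : TwoSidedSeq R,
    (∀ n, Module.Projective R (X.left n)) ∧
    (∀ n, ∃ P : ModuleCat.{u} R, Module.Projective R P ∧
      Nonempty (X.right n ≃ₗ[R] C ⊗[R] P)) ∧
    X.IsExact ∧
    Nonempty (M ≃ₗ[R] LinearMap.range X.mid) ∧
    ∀ P : ModuleCat.{u} R, Module.Projective R P → X.IsHomExact (C ⊗[R] P)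

/-- `G_C`-flat modules. -/
def IsGCFlat (M : Type u) [AddCommGroup M] [Module R M] : Prop :=
  ∃ X : TwoSidedSeq R,
    (∀ n, Module.Flat R (X.left n)) ∧
    (∀ n, ∃ F : ModuleCat.{u} R, Module.Flat R F ∧
      Nonempty (X.right n ≃ₗ[R] C ⊗[R] F)) ∧
    X.IsExact ∧
    Nonempty (M ≃ₗ[R] LinearMap.range X.mid) ∧
    ∀ I : ModuleCat.{u} R, Module.Injective R I → X.IsTensorExact (C →ₗ[R] I)

/-- The `G_C`-flat dimension of a module. -/
noncomputable def gcFlatDim (M : Type u) [AddCommGroup M] [Module R M] : ℕ∞ :=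
  relProjDim (fun N : ModuleCat.{u} R => IsGCFlat R C N) M

/-- The `C`-Gorenstein weak global dimension of `R`. -/
noncomputable def gcWeakGlobalDim : ℕ∞ :=
  ⨆ M : ModuleCat.{u} R, gcFlatDim R C M

/-- A commutative ring is coherent if its finitely generated ideals are finitely presented. -/
def IsCoherent : Prop :=
  ∀ I : Ideal R, I.FG → Module.FinitePresentation R I

/-- `R` is `C`-Gorenstein semihereditary. -/
def IsGCSemihereditary : Prop :=
  IsCoherent R ∧
    ∀ F : ModuleCat.{u} R, Module.Flat R F → ∀ N : Submodule R F, IsGCFlat R C N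

end

end GCModules

/-! For a module to be `G_C`-flat it suffices that `Tor₁(Hom(C, E), -)` vanishes on it for every
injective `E`, and that it has an infinite coresolution by modules `C ⊗ F`, `F` flat, whose
cosyzygies have the same vanishing. The proof arranges both for submodules of flat modules.

Finitely generated submodules of `Cˢ` are `G_C`-projective because `C ⊗ P` is, and those of `Rˢ`
embed in a power of `C` because `R` acts faithfully on it. A finite `G_C`-projective `M` is the
kernel of some `Cˢ → Cᵗ` along which maps to `C` extend; hence `M` is `C`-reflexive, its dual
`Hom(M, C)` is again finite `G_C`-projective, and such duals are finitely presented. So `M` is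
finitely presented (`FGSubmodulesGCProjective.finitePresentation`), and `R` is coherent.

For finitely presented `M` and injective `E`, `M ⊗ Hom(C, E) ≅ Hom(Hom(M, C), E)`
(`homEval_bijective`). This turns extension of maps into `C` into `Tor₁(Hom(C, E), I) = 0` for
finitely generated ideals `I`, so `Hom(C, E)` has flat dimension at most one. The class
`HomTorVanishes` is therefore closed under submodules; it contains all flat modules and all `C ⊗ F`.

The duals `Hom(Hom(C, E), R⁺)`, with `R⁺` the character module, are of the form `C ⊗ F` and are
injective relative to exact sequences with cokernel in `HomTorVanishes`. Pushouts and a horseshoe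
argument carry coresolutions by these duals along a finite `G_C`-flat resolution
(`HasCoresolution.quotient`). This is where the finite global dimension enters: every module in
`HomTorVanishes` embeds in some `C ⊗ F` with cokernel in the same class, and iterating gives the
coresolution. -/

namespace GCModules

/-! ### Extending maps when `Ext` vanishes -/

open CategoryTheory CategoryTheory.Abelian in
/-- In a short exact sequence with projective middle term, vanishing of the higher `Ext` into `N`
passes from the quotient to the submodule, and maps into `N` extend. -/
theorem ext_subsingleton_and_extend {R : Type u} [CommRing R] {K F M N : Type u}
    [AddCommGroup K] [Module R K] [AddCommGroup F] [Module R F] [AddCommGroup M] [Module R M]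
    [AddCommGroup N] [Module R N] [Module.Projective R F] (f : K →ₗ[R] F) (g : F →ₗ[R] M)
    (hf : Function.Injective f) (hfg : Function.Exact f g) (hg : Function.Surjective g)
    (h : ∀ i, 1 ≤ i → Subsingleton (Ext (ModuleCat.of R M) (ModuleCat.of R N) i)) :
    (∀ i, 1 ≤ i → Subsingleton (Ext (ModuleCat.of R K) (ModuleCat.of R N) i)) ∧
      ∀ φ : K →ₗ[R] N, ∃ ψ : F →ₗ[R] N, ψ ∘ₗ f = φ := by
  let S : ShortComplex (ModuleCat.{u} R) :=
    ShortComplex.mk (ModuleCat.ofHom f) (ModuleCat.ofHom g)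
      (by ext x; exact hfg.apply_apply_eq_zero x)
  have hS : S.ShortExact :=
    { exact := (ShortComplex.ShortExact.moduleCat_exact_iff_function_exact _).mpr hfg
      mono_f := (ModuleCat.mono_iff_injective _).mpr hf
      epi_g := (ModuleCat.epi_iff_surjective _).mpr hg }
  -- The connecting map lands in `Ext` of `M` one degree higher, which is zero. The case `i = 0` is
  -- the extension of maps.
  have key : ∀ i (x : Ext (ModuleCat.of R K) (ModuleCat.of R N) i),
      ∃ y : Ext (ModuleCat.of R F) (ModuleCat.of R N) i,
        (Ext.mk₀ (ModuleCat.ofHom f)).comp y (zero_add i) = x := fun i x => by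
    have := h (1 + i) (by lia)
    exact Ext.contravariant_sequence_exact₁ hS (ModuleCat.of R N) x rfl (Subsingleton.elim _ _)
  have : Projective (ModuleCat.of R F) :=
    (IsProjective.iff_projective F).mp inferInstance
  constructor
  · intro i hi
    obtain ⟨j, rfl⟩ := Nat.exists_eq_add_of_le' hi
    refine ⟨fun x y => ?_⟩
    have : ∀ x : Ext (ModuleCat.of R K) (ModuleCat.of R N) (j + 1), x = 0 := fun x => by
      obtain ⟨y, rfl⟩ := key _ x
      rw [Ext.eq_zero_of_projective y, Ext.comp_zero]
    rw [this x, this y]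
  · intro φ
    obtain ⟨y, hy⟩ := key 0 (Ext.mk₀ (ModuleCat.ofHom φ))
    obtain ⟨ψ, rfl⟩ := Ext.addEquiv₀.symm.surjective y
    refine ⟨ψ.hom, ?_⟩
    have hy' : Ext.mk₀ (ModuleCat.ofHom f ≫ ψ) = Ext.mk₀ (ModuleCat.ofHom φ) := by
      rw [← hy]; exact (Ext.mk₀_comp_mk₀ _ _).symm
    have := (Ext.mk₀_bijective _ _).injective hy'
    exact congrArg ModuleCat.Hom.hom this

section

variable {R : Type u} [CommRing R] {C : Type u} [AddCommGroup C] [Module R C]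

theorem exists_factor_of_surjective {A B D : Type*} [AddCommGroup A] [Module R A]
    [AddCommGroup B] [Module R B] [AddCommGroup D] [Module R D] {g : A →ₗ[R] B} {k : A →ₗ[R] D}
    (hg : Function.Surjective g)
    (h : ∀ x, g x = 0 → k x = 0) : ∃ v : B →ₗ[R] D, ∀ x, v (g x) = k x := by
  refine ⟨(LinearMap.ker g).liftQ k h ∘ₗ (g.quotKerEquivOfSurjective hg).symm.toLinearMap,
    fun x => ?_⟩
  have h2 : (g.quotKerEquivOfSurjective hg).symm (g x) = Submodule.Quotient.mk x := by
    rw [LinearEquiv.symm_apply_eq]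
    rfl
  rw [LinearMap.comp_apply, LinearEquiv.coe_coe, h2]
  rfl

/-- Along a projective resolution of `C`, maps from syzygies to `N` extend as soon as the higher
`Ext` of `C` and `N` vanish. -/
theorem LeftResolution.extend_of_ext {N : Type u} [AddCommGroup N] [Module R N]
    (X : LeftResolution R C) (hX : ∀ n, Module.Projective R (X.obj n))
    (h : ∀ i, 1 ≤ i → Subsingleton
      (CategoryTheory.Abelian.Ext (ModuleCat.of R C) (ModuleCat.of R N) i)) (n : ℕ)
    (φ : LinearMap.range (X.d n) →ₗ[R] N) :
    ∃ ψ : X.obj n →ₗ[R] N, ψ ∘ₗ (LinearMap.range (X.d n)).subtype = φ := by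
  suffices H : (∀ i, 1 ≤ i → Subsingleton (CategoryTheory.Abelian.Ext
      (ModuleCat.of R (LinearMap.range (X.d n))) (ModuleCat.of R N) i)) ∧
      ∀ φ : LinearMap.range (X.d n) →ₗ[R] N,
        ∃ ψ : X.obj n →ₗ[R] N, ψ ∘ₗ (LinearMap.range (X.d n)).subtype = φ from H.2 φ
  clear φ
  induction n with
  | zero =>
    have := hX 0
    refine ext_subsingleton_and_extend _ X.ε (Submodule.subtype_injective _) ?_ X.surjective_ε h
    rw [LinearMap.exact_iff, Submodule.range_subtype]
    exact X.exact_ε.linearMap_ker_eq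
  | succ n ih =>
    have := hX (n + 1)
    refine ext_subsingleton_and_extend _ (X.d n).rangeRestrict (Submodule.subtype_injective _) ?_
      (LinearMap.surjective_rangeRestrict _) ih.1
    rw [LinearMap.exact_iff, Submodule.range_subtype, LinearMap.ker_rangeRestrict]
    exact (X.exact_d n).linearMap_ker_eq

/-- For `P` projective, `C ⊗ P` is a retract of a direct sum of copies of `C`. -/
theorem exists_retract_finsupp (C : Type u) [AddCommGroup C] [Module R C] (P : Type u)
    [AddCommGroup P] [Module R P] [Module.Projective R P] :
    ∃ (i : C ⊗[R] P →ₗ[R] (P →₀ C)) (r : (P →₀ C) →ₗ[R] C ⊗[R] P), r ∘ₗ i = LinearMap.id := by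
  classical
  obtain ⟨s, hs⟩ := Module.projective_def'.mp (inferInstance : Module.Projective R P)
  let e := TensorProduct.finsuppScalarRight R R C P
  refine ⟨e.toLinearMap ∘ₗ s.lTensor C,
    (Finsupp.linearCombination R id).lTensor C ∘ₗ e.symm.toLinearMap, ?_⟩
  ext c p
  have := LinearMap.congr_fun hs p
  simp only [LinearMap.comp_apply, LinearMap.id_apply] at this
  simp [this]

/-- A linear map from a finite module to a direct sum of copies of `C` has image in a finite
subsum. -/
theorem exists_factor_finsupp {K : Type u} [AddCommGroup K] [Module R K] [Module.Finite R K]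
    {S : Type u} (φ : K →ₗ[R] (S →₀ C)) :
    ∃ (s : Finset S) (a : K →ₗ[R] (s → C)) (b : (s → C) →ₗ[R] (S →₀ C)),
      Function.Injective b ∧ b ∘ₗ a = φ := by
  classical
  obtain ⟨t, ht⟩ := (Module.Finite.fg_top : (⊤ : Submodule R K).FG)
  let s : Finset S := t.biUnion fun k => (φ k).support
  have hs : ∀ k, φ k ∈ Finsupp.supported C R (s : Set S) := by
    suffices h : (⊤ : Submodule R K) ≤ (Finsupp.supported C R (s : Set S)).comap φ from
      fun k => h Submodule.mem_top
    rw [← ht, Submodule.span_le]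
    intro k hk
    change φ k ∈ Finsupp.supported C R (s : Set S)
    rw [Finsupp.mem_supported]
    exact_mod_cast Finset.subset_biUnion_of_mem (fun k => (φ k).support) hk
  let e : Finsupp.supported C R (s : Set S) ≃ₗ[R] (s → C) :=
    (Finsupp.supportedEquivFinsupp (s : Set S)).trans (Finsupp.linearEquivFunOnFinite R C s)
  refine ⟨s, e.toLinearMap ∘ₗ φ.codRestrict _ hs,
    (Finsupp.supported C R (s : Set S)).subtype ∘ₗ e.symm.toLinearMap,
    (Submodule.subtype_injective _).comp e.symm.injective, ?_⟩
  ext1 k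
  simp

/-- Extension of maps into `C` along a map out of a finite module gives extension of maps into
`C ⊗ P` for `P` projective. -/
theorem extend_tensor {K F : Type u} [AddCommGroup K] [Module R K] [Module.Finite R K]
    [AddCommGroup F] [Module R F] (f : K →ₗ[R] F)
    (h : ∀ φ : K →ₗ[R] C, ∃ ψ : F →ₗ[R] C, ψ ∘ₗ f = φ) (P : Type u) [AddCommGroup P]
    [Module R P] [Module.Projective R P] (φ : K →ₗ[R] C ⊗[R] P) :
    ∃ ψ : F →ₗ[R] C ⊗[R] P, ψ ∘ₗ f = φ := by
  obtain ⟨i, r, hr⟩ := exists_retract_finsupp (R := R) C P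
  obtain ⟨s, a, b, -, hab⟩ := exists_factor_finsupp (i ∘ₗ φ)
  choose ψ hψ using fun j : s => h (LinearMap.proj j ∘ₗ a)
  refine ⟨r ∘ₗ b ∘ₗ LinearMap.pi ψ, ?_⟩
  have : LinearMap.pi ψ ∘ₗ f = a := by
    ext k j
    exact LinearMap.congr_fun (hψ j) k
  rw [LinearMap.comp_assoc, LinearMap.comp_assoc, this, hab, ← LinearMap.comp_assoc, hr,
    LinearMap.id_comp]

theorem exists_lift_of_exact {A B D P : Type*} [AddCommGroup A] [Module R A] [AddCommGroup B]
    [Module R B] [AddCommGroup D] [Module R D] [AddCommGroup P] [Module R P]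
    [Module.Projective R P] {f : A →ₗ[R] B} {g : B →ₗ[R] D} (h : Function.Exact f g)
    (v : P →ₗ[R] B) (hv : g ∘ₗ v = 0) : ∃ w : P →ₗ[R] A, f ∘ₗ w = v := by
  have hm : ∀ p, v p ∈ LinearMap.range f := fun p => (h _).mp (LinearMap.congr_fun hv p)
  obtain ⟨w, hw⟩ := Module.projective_lifting_property f.rangeRestrict (v.codRestrict _ hm)
    (LinearMap.surjective_rangeRestrict f)
  exact ⟨w, by ext p; exact congrArg Subtype.val (LinearMap.congr_fun hw p)⟩

/-- `Hom(- ⊗ P, W) = Hom(P, Hom(-, W))`, and `Hom(P, -)` is exact. -/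
theorem exact_lcomp_rTensor {A B D P W : Type u} [AddCommGroup A] [Module R A] [AddCommGroup B]
    [Module R B] [AddCommGroup D] [Module R D] [AddCommGroup P] [Module R P]
    [AddCommGroup W] [Module R W] [Module.Projective R P] {f : A →ₗ[R] B} {g : B →ₗ[R] D}
    (h : Function.Exact (g.lcomp R W) (f.lcomp R W)) :
    Function.Exact ((g.rTensor P).lcomp R W) ((f.rTensor P).lcomp R W) := by
  intro φ
  constructor
  · intro hφ
    obtain ⟨w, hw⟩ := exists_lift_of_exact h (TensorProduct.curry φ).flip (by
      ext p a
      exact LinearMap.congr_fun hφ (a ⊗ₜ p))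
    refine ⟨TensorProduct.lift w.flip, ?_⟩
    ext b p
    exact LinearMap.congr_fun (LinearMap.congr_fun hw p) b
  · rintro ⟨ψ, rfl⟩
    ext a p
    have := LinearMap.congr_fun (h.apply_apply_eq_zero
      (ψ ∘ₗ (TensorProduct.mk R D P).flip p)) a
    exact this

end

/-! ### `G_C`-projectivity of `C ⊗ P` -/

section

variable {R : Type u} [CommRing R] {C : Type u} [AddCommGroup C] [Module R C]

/-- The two-sided sequence `⋯ → X₁ ⊗ P → X₀ ⊗ P → C ⊗ P → 0 → 0 → ⋯`. -/
noncomputable def LeftResolution.tensorSeq (X : LeftResolution R C) (P : ModuleCat.{u} R) :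
    TwoSidedSeq R where
  left n := ModuleCat.of R (X.obj n ⊗[R] P)
  right n := match n with
    | 0 => ModuleCat.of R (C ⊗[R] P)
    | _ + 1 => ModuleCat.of R PUnit
  dLeft n := (X.d n).rTensor P
  mid := X.ε.rTensor P
  dRight _ := 0

/-- A finite projective resolution of `C`, tensored with `P` and continued by zeros, is a witness.
Vanishing of `Ext(C, C)` extends maps from the syzygies into `C`; as the syzygies are finitely
generated, this passes to maps into `C ⊗ P'`. -/
theorem IsSemidualizing.isGCProjective_tensor (hC : IsSemidualizing R C) (P : ModuleCat.{u} R)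
    [Module.Projective R P] : IsGCProjective R C (C ⊗[R] P) := by
  obtain ⟨X, hX⟩ := hC.exists_resolution
  have hfin n := (hX n).1
  have hproj n := (hX n).2
  have hε : Function.Surjective (X.ε.rTensor P) := LinearMap.rTensor_surjective P X.surjective_ε
  refine ⟨X.tensorSeq P, fun n => ?_, fun n => ?_, ⟨fun n => ?_, ?_, ?_, fun n => ?_⟩, ?_,
    fun P' hP' => ⟨fun n => ?_, ?_, ?_, fun n => ?_⟩⟩
  · change Module.Projective R (X.obj n ⊗[R] P)
    infer_instance
  · cases n with
    | zero => exact ⟨P, inferInstance, ⟨LinearEquiv.refl R _⟩⟩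
    | succ n =>
      refine ⟨ModuleCat.of R PUnit, inferInstanceAs (Module.Projective R PUnit.{u+1}), ⟨?_⟩⟩
      exact (0 : PUnit.{u+1} ≃ₗ[R] C ⊗[R] PUnit.{u+1})
  · exact Module.Flat.rTensor_exact P (X.exact_d n)
  · exact Module.Flat.rTensor_exact P X.exact_ε
  · intro y
    exact ⟨fun _ => hε y, fun _ => rfl⟩
  · intro y
    exact ⟨fun _ => ⟨0, Subsingleton.elim (α := PUnit) _ _⟩, fun _ => rfl⟩
  · exact ⟨(LinearEquiv.ofTop _ (LinearMap.range_eq_top.mpr hε)).symm⟩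
  · refine exact_lcomp_rTensor fun φ => ⟨fun hφ => ?_, ?_⟩
    · obtain ⟨φ', hφ'⟩ := exists_factor_of_surjective (k := φ)
        (LinearMap.surjective_rangeRestrict (X.d n)) (fun x hx => by
          obtain ⟨y, rfl⟩ := (X.exact_d n x).mp (congrArg Subtype.val hx)
          exact LinearMap.congr_fun hφ y)
      obtain ⟨ψ, hψ⟩ := extend_tensor (LinearMap.range (X.d n)).subtype
        (X.extend_of_ext hproj hC.ext_eq_zero n) P' φ'
      refine ⟨ψ, ?_⟩
      ext x
      exact (LinearMap.congr_fun hψ ((X.d n).rangeRestrict x)).trans (hφ' x)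
    · rintro ⟨ψ, rfl⟩
      ext x
      change ψ (X.d n (X.d (n + 1) x)) = 0
      rw [(X.exact_d n).apply_apply_eq_zero, map_zero]
  · refine exact_lcomp_rTensor fun φ => ⟨fun hφ => ?_, ?_⟩
    · obtain ⟨ψ, hψ⟩ := exists_factor_of_surjective (k := φ) X.surjective_ε (fun x hx => by
        obtain ⟨y, rfl⟩ := (X.exact_ε x).mp hx
        exact LinearMap.congr_fun hφ y)
      exact ⟨ψ, LinearMap.ext hψ⟩
    · rintro ⟨ψ, rfl⟩
      ext x
      change ψ (X.ε (X.d 0 x)) = 0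
      rw [X.exact_ε.apply_apply_eq_zero, map_zero]
  · intro φ
    constructor
    · intro hφ
      refine ⟨0, LinearMap.ext fun y => ?_⟩
      obtain ⟨x, rfl⟩ := hε y
      exact (LinearMap.congr_fun hφ x).symm
    · rintro ⟨ψ, rfl⟩
      ext x
      exact map_zero ψ
  · intro φ
    have : Subsingleton ((X.tensorSeq P).right (n + 1)) := inferInstanceAs (Subsingleton PUnit)
    refine ⟨fun _ => ⟨0, LinearMap.ext fun y => ?_⟩, ?_⟩
    · rw [Subsingleton.elim y 0, map_zero, map_zero]
    · rintro ⟨ψ, rfl⟩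
      ext x
      exact map_zero ψ

end

/-! ### Embeddings and covers of `G_C`-projective modules -/

section

variable {R : Type u} [CommRing R] {C : Type u} [AddCommGroup C] [Module R C]

theorem IsGCProjective.of_equiv {M N : Type u} [AddCommGroup M] [Module R M] [AddCommGroup N]
    [Module R N] (e : M ≃ₗ[R] N) (h : IsGCProjective R C M) : IsGCProjective R C N := by
  obtain ⟨X, h₁, h₂, h₃, ⟨e'⟩, h₄⟩ := h
  exact ⟨X, h₁, h₂, h₃, ⟨e.symm.trans e'⟩, h₄⟩

theorem exact_lcomp_of_equiv {A B D W W' : Type u} [AddCommGroup A] [Module R A] [AddCommGroup B]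
    [Module R B] [AddCommGroup D] [Module R D] [AddCommGroup W] [Module R W] [AddCommGroup W']
    [Module R W'] (e : W ≃ₗ[R] W') {f : A →ₗ[R] B} {g : B →ₗ[R] D}
    (h : Function.Exact (g.lcomp R W) (f.lcomp R W)) :
    Function.Exact (g.lcomp R W') (f.lcomp R W') :=
  (Function.Exact.iff_of_ladder_linearEquiv (e₁ := e.congrRight) (e₂ := e.congrRight)
    (e₃ := e.congrRight) (by ext; rfl) (by ext; rfl)).mpr h

/-- A `G_C`-projective module is a kernel of some `C ⊗ P₀ → C ⊗ P₁`, with extension of maps to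
`C`. -/
theorem IsGCProjective.exists_embedding {M : Type u} [AddCommGroup M] [Module R M]
    (h : IsGCProjective R C M) :
    ∃ (P₀ P₁ : ModuleCat.{u} R) (i : M →ₗ[R] C ⊗[R] P₀) (d : C ⊗[R] P₀ →ₗ[R] C ⊗[R] P₁),
      Module.Projective R P₀ ∧ Module.Projective R P₁ ∧ Function.Injective i ∧
      Function.Exact i d ∧ ∀ φ : M →ₗ[R] C, ∃ ψ : C ⊗[R] P₀ →ₗ[R] C, ψ ∘ₗ i = φ := by
  obtain ⟨X, h₁, h₂, h₃, ⟨e⟩, h₄⟩ := h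
  obtain ⟨P₀, hP₀, ⟨e₀⟩⟩ := h₂ 0
  obtain ⟨P₁, hP₁, ⟨e₁⟩⟩ := h₂ 1
  have hR := h₄ (ModuleCat.of R R) (inferInstanceAs (Module.Projective R R))
  refine ⟨P₀, P₁, e₀.toLinearMap ∘ₗ (LinearMap.range X.mid).subtype ∘ₗ e.toLinearMap,
    e₁.toLinearMap ∘ₗ X.dRight 0 ∘ₗ e₀.symm.toLinearMap, hP₀, hP₁,
    e₀.injective.comp ((Submodule.subtype_injective _).comp e.injective), ?_, ?_⟩
  · intro y
    obtain ⟨y, rfl⟩ := e₀.surjective y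
    simp only [LinearMap.comp_apply, LinearEquiv.coe_coe, LinearEquiv.symm_apply_apply,
      LinearEquiv.map_eq_zero_iff, Set.mem_range, EmbeddingLike.apply_eq_iff_eq]
    rw [h₃.mid_right y]
    constructor
    · rintro ⟨x, rfl⟩
      exact ⟨e.symm ⟨_, x, rfl⟩, by simp⟩
    · rintro ⟨m, rfl⟩
      exact (e m).2
  · intro φ
    let p : X.left 0 →ₗ[R] M := e.symm.toLinearMap ∘ₗ X.mid.rangeRestrict
    obtain ⟨ψ, hψ⟩ := (exact_lcomp_of_equiv (TensorProduct.rid R C) hR.left_mid (φ ∘ₗ p)).mp (by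
      ext x
      have : X.mid.rangeRestrict (X.dLeft 0 x) = 0 :=
        Subtype.ext (h₃.left_mid.apply_apply_eq_zero x)
      simp [p, this])
    refine ⟨ψ ∘ₗ e₀.symm.toLinearMap, ?_⟩
    ext m
    obtain ⟨x, hx⟩ := (e m).2
    have h1 := LinearMap.congr_fun hψ x
    have h2 : X.mid.rangeRestrict x = e m := Subtype.ext hx
    simp only [LinearMap.lcomp_apply', LinearMap.comp_apply, p, h2, LinearEquiv.coe_coe,
      LinearEquiv.symm_apply_apply, hx] at h1
    simpa using h1

/-- Over some projective cover of a `G_C`-projective module, maps from the syzygy to `C` extend. -/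
theorem IsGCProjective.exists_cover {M : Type u} [AddCommGroup M] [Module R M]
    (h : IsGCProjective R C M) :
    ∃ (P : ModuleCat.{u} R) (p : P →ₗ[R] M), Module.Projective R P ∧ Function.Surjective p ∧
      ∀ φ : LinearMap.ker p →ₗ[R] C, ∃ ψ : P →ₗ[R] C, ψ ∘ₗ (LinearMap.ker p).subtype = φ := by
  obtain ⟨X, h₁, h₂, h₃, ⟨e⟩, h₄⟩ := h
  have hR := h₄ (ModuleCat.of R R) (inferInstanceAs (Module.Projective R R))
  let p : X.left 0 →ₗ[R] M := e.symm.toLinearMap ∘ₗ X.mid.rangeRestrict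
  have hker : ∀ x, p x = 0 ↔ x ∈ Set.range (X.dLeft 0) := fun x => by
    rw [← h₃.left_mid x]
    simp only [p, LinearMap.comp_apply, LinearEquiv.coe_coe, LinearEquiv.map_eq_zero_iff]
    exact Subtype.ext_iff
  have hmem : ∀ y, X.dLeft 0 y ∈ LinearMap.ker p := fun y => (hker _).mpr ⟨y, rfl⟩
  refine ⟨X.left 0, p, h₁ 0,
    e.symm.surjective.comp (LinearMap.surjective_rangeRestrict _), fun φ => ?_⟩
  obtain ⟨ψ, hψ⟩ := (exact_lcomp_of_equiv (TensorProduct.rid R C) (hR.left 0)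
    (φ ∘ₗ (X.dLeft 0).codRestrict _ hmem)).mp (by
      ext x
      have : (X.dLeft 0).codRestrict _ hmem (X.dLeft 1 x) = 0 :=
        Subtype.ext ((h₃.left 0).apply_apply_eq_zero x)
      simp [this])
  refine ⟨ψ, ?_⟩
  ext ⟨x, hx⟩
  obtain ⟨y, rfl⟩ := (hker x).mp hx
  exact LinearMap.congr_fun hψ y

/-- Extension of maps from a syzygy of `M` does not depend on the projective cover. -/
theorem extend_of_projective_cover {M P F N : Type u} [AddCommGroup M] [Module R M]
    [AddCommGroup P] [Module R P] [AddCommGroup F] [Module R F] [AddCommGroup N] [Module R N]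
    [Module.Projective R P] [Module.Projective R F] (p : P →ₗ[R] M) (q : F →ₗ[R] M)
    (hp : Function.Surjective p) (hq : Function.Surjective q)
    (h : ∀ φ : LinearMap.ker p →ₗ[R] N, ∃ ψ : P →ₗ[R] N, ψ ∘ₗ (LinearMap.ker p).subtype = φ)
    (φ : LinearMap.ker q →ₗ[R] N) : ∃ ψ : F →ₗ[R] N, ψ ∘ₗ (LinearMap.ker q).subtype = φ := by
  obtain ⟨a, ha⟩ := Module.projective_lifting_property q p hq
  obtain ⟨b, hb⟩ := Module.projective_lifting_property p q hp
  have ha' : ∀ x, q (a x) = p x := LinearMap.congr_fun ha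
  have hb' : ∀ x, p (b x) = q x := LinearMap.congr_fun hb
  let a' : LinearMap.ker p →ₗ[R] LinearMap.ker q :=
    (a ∘ₗ (LinearMap.ker p).subtype).codRestrict _ fun x => by
      simp [ha']
  obtain ⟨ψ, hψ⟩ := h (φ ∘ₗ a')
  -- The comparison `a ∘ b` is the identity up to a map into `ker q`, and `φ` is already defined
  -- there; this corrects `ψ ∘ b`.
  let c : F →ₗ[R] LinearMap.ker q := (LinearMap.id - a ∘ₗ b).codRestrict _ fun x => by
    simp [ha', hb']
  refine ⟨ψ ∘ₗ b + φ ∘ₗ c, ?_⟩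
  ext x
  have hbx : b x ∈ LinearMap.ker p := by
    have := x.2
    rw [LinearMap.mem_ker] at this ⊢
    rw [hb', this]
  have h1 := LinearMap.congr_fun hψ ⟨b x, hbx⟩
  simp only [LinearMap.comp_apply, Submodule.subtype_apply] at h1
  simp only [LinearMap.comp_apply, LinearMap.add_apply, Submodule.subtype_apply, h1, ← map_add]
  congr 1
  exact Subtype.ext (add_sub_cancel (a (b x)) (x : F))

/-- A finite `G_C`-projective module is a kernel of some `Cˢ → Cᵗ`, with extension of maps to
`C`. -/
theorem IsGCProjective.exists_finite_embedding [Module.Finite R C] {M : Type u} [AddCommGroup M]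
    [Module R M] [Module.Finite R M] (h : IsGCProjective R C M) :
    ∃ (s t : Type u) (_ : Finite s) (_ : Finite t) (j : M →ₗ[R] (s → C))
      (q : (s → C) →ₗ[R] (t → C)), Function.Injective j ∧ Function.Exact j q ∧
      ∀ φ : M →ₗ[R] C, ∃ ψ : (s → C) →ₗ[R] C, ψ ∘ₗ j = φ := by
  obtain ⟨P₀, P₁, i, d, _, _, hi, hid, hext⟩ := h.exists_embedding
  obtain ⟨ι, r, hr⟩ := exists_retract_finsupp (R := R) C P₀
  obtain ⟨ι₁, r₁, hr₁⟩ := exists_retract_finsupp (R := R) C P₁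
  have hr' : ∀ x, r (ι x) = x := LinearMap.congr_fun hr
  have hι₁ : Function.Injective ι₁ := Function.LeftInverse.injective (LinearMap.congr_fun hr₁)
  have hι : Function.Injective ι := Function.LeftInverse.injective hr'
  obtain ⟨s, a, b, hb, hab⟩ := exists_factor_finsupp (ι ∘ₗ i)
  have hab' : ∀ m, b (a m) = ι (i m) := LinearMap.congr_fun hab
  -- The finite subsum need not lie in the summand `C ⊗ P₀`. The second component forces `b x` into
  -- that summand, and the first forces it into the kernel of `d`.
  let q : (s → C) →ₗ[R] ((P₁ ⊕ P₀) →₀ C) :=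
    (Finsupp.sumFinsuppLEquivProdFinsupp R).symm.toLinearMap ∘ₗ
      (ι₁ ∘ₗ d ∘ₗ r ∘ₗ b).prod (b - ι ∘ₗ r ∘ₗ b)
  have hq : ∀ x, q x = 0 ↔ d (r (b x)) = 0 ∧ b x = ι (r (b x)) := fun x => by
    simp only [q, LinearMap.comp_apply, LinearEquiv.coe_coe, LinearEquiv.map_eq_zero_iff,
      LinearMap.prod_apply, Function.prod_apply, Prod.mk_eq_zero, LinearMap.sub_apply, sub_eq_zero,
      map_eq_zero_iff _ hι₁]
  obtain ⟨t, a', b', hb', hab''⟩ := exists_factor_finsupp q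
  refine ⟨s, t, inferInstance, inferInstance, a, a', ?_, ?_, ?_⟩
  · refine Function.Injective.of_comp (f := b) ?_
    rw [← LinearMap.coe_comp, hab]
    exact hι.comp hi
  · intro x
    have h1 : a' x = 0 ↔ q x = 0 := by
      rw [← hab'', LinearMap.comp_apply, map_eq_zero_iff _ hb']
    rw [h1, hq]
    constructor
    · rintro ⟨h2, h3⟩
      obtain ⟨m, hm⟩ := (hid _).mp h2
      exact ⟨m, hb (by rw [hab', hm, ← h3])⟩
    · rintro ⟨m, rfl⟩
      rw [hab', hr']
      exact ⟨hid.apply_apply_eq_zero m, rfl⟩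
  · intro φ
    obtain ⟨ψ, rfl⟩ := hext φ
    refine ⟨ψ ∘ₗ r ∘ₗ b, ?_⟩
    ext m
    simp [hab', hr']

end

/-! ### Reflexivity of finite `G_C`-projective modules, and coherence -/

/-- Every finitely generated submodule of a `G_C`-projective module is `G_C`-projective. -/
def FGSubmodulesGCProjective (R : Type u) [CommRing R] (C : Type u) [AddCommGroup C]
    [Module R C] : Prop :=
  ∀ G : ModuleCat.{u} R, IsGCProjective R C G →
    ∀ N : Submodule R G, N.FG → IsGCProjective R C N

section

variable {R : Type u} [CommRing R] {C : Type u} [AddCommGroup C] [Module R C]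

theorem IsSemidualizing.finite (hC : IsSemidualizing R C) : Module.Finite R C := by
  obtain ⟨X, hX⟩ := hC.exists_resolution
  have := (hX 0).1
  exact Module.Finite.of_surjective X.ε X.surjective_ε

theorem FGSubmodulesGCProjective.of_injective_pi (hC : IsSemidualizing R C)
    (hsub : FGSubmodulesGCProjective R C) {N : Type u} [AddCommGroup N] [Module R N]
    [Module.Finite R N] {s : Type u} [Finite s] (i : N →ₗ[R] (s → C))
    (hi : Function.Injective i) : IsGCProjective R C N := by
  classical
  have : Module.Projective R (ModuleCat.of R (s →₀ R)) :=
    inferInstanceAs (Module.Projective R (s →₀ R))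
  let e : (s → C) ≃ₗ[R] C ⊗[R] (s →₀ R) :=
    (Finsupp.linearEquivFunOnFinite R C s).symm.trans
      (TensorProduct.finsuppScalarRight R R C s).symm
  let i' : N →ₗ[R] C ⊗[R] (s →₀ R) := e.toLinearMap ∘ₗ i
  have h := hsub (ModuleCat.of R (C ⊗[R] (s →₀ R)))
    (hC.isGCProjective_tensor (ModuleCat.of R (s →₀ R))) (LinearMap.range i')
    (Module.Finite.iff_fg.mp (Module.Finite.range i'))
  exact h.of_equiv (LinearEquiv.ofInjective i' (e.injective.comp hi)).symm

theorem IsSemidualizing.eq_smul (hC : IsSemidualizing R C) (φ : C →ₗ[R] C) :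
    ∃ r : R, ∀ c, φ c = r • c := by
  obtain ⟨r, hr⟩ := hC.bijective_homothety.2 φ
  exact ⟨r, fun c => by rw [← hr]; rfl⟩

theorem IsSemidualizing.finitePresentation_pi_hom (hC : IsSemidualizing R C) (s : Type u)
    [Finite s] : Module.FinitePresentation R ((s → C) →ₗ[R] C) := by
  classical
  have := Fintype.ofFinite s
  have : Module.FinitePresentation R (C →ₗ[R] C) :=
    .of_equiv (LinearEquiv.ofBijective (LinearMap.lsmul R C) hC.bijective_homothety)
  exact .of_equiv (LinearMap.lsum R (fun _ : s => C) R)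

/-- The dual into `C` of a finite `G_C`-projective module is finitely generated. -/
theorem IsGCProjective.finite_hom {M : Type u} [AddCommGroup M] [Module R M]
    [Module.Finite R M] (h : IsGCProjective R C M) (hC : IsSemidualizing R C) :
    Module.Finite R (M →ₗ[R] C) := by
  have := hC.finite
  obtain ⟨s, t, _, _, j, q, hj, hjq, hext⟩ := h.exists_finite_embedding
  have := hC.finitePresentation_pi_hom s
  exact Module.Finite.of_surjective (j.lcomp R C) hext

/-- The dual into `C` of a finite `G_C`-projective module is finitely presented. -/
theorem FGSubmodulesGCProjective.finitePresentation_hom (hC : IsSemidualizing R C)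
    (hsub : FGSubmodulesGCProjective R C) {M : Type u} [AddCommGroup M] [Module R M]
    [Module.Finite R M] (h : IsGCProjective R C M) :
    Module.FinitePresentation R (M →ₗ[R] C) := by
  have := hC.finite
  obtain ⟨s, t, _, _, j, q, hj, hjq, hext⟩ := h.exists_finite_embedding
  have := hC.finitePresentation_pi_hom s
  -- The dual of this image is the kernel of `Hom(Cˢ, C) → Hom(M, C)`, so its finiteness gives the
  -- finite presentation.
  have hN : IsGCProjective R C (LinearMap.range q) :=
    hsub.of_injective_pi hC (LinearMap.range q).subtype (Submodule.subtype_injective _)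
  have := hN.finite_hom hC
  refine Module.finitePresentation_of_surjective (j.lcomp R C) hext ?_
  have hex : Function.Exact j q.rangeRestrict := by
    rw [LinearMap.exact_iff, LinearMap.ker_rangeRestrict]
    exact hjq.linearMap_ker_eq
  rw [(LinearMap.exact_lcomp_of_exact_of_surjective C hex
    (LinearMap.surjective_rangeRestrict q)).linearMap_ker_eq]
  exact Module.Finite.iff_fg.mp (Module.Finite.range _)

/-- Finite `G_C`-projective modules are finitely presented. -/
theorem FGSubmodulesGCProjective.finitePresentation (hC : IsSemidualizing R C)
    (hsub : FGSubmodulesGCProjective R C) {M : Type u} [AddCommGroup M] [Module R M]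
    [Module.Finite R M] (h : IsGCProjective R C M) : Module.FinitePresentation R M := by
  classical
  have := hC.finite
  have := hsub.finitePresentation_hom hC h
  obtain ⟨t, ht⟩ := (Module.Finite.fg_top : (⊤ : Submodule R M).FG)
  -- Evaluation at a finite generating set embeds the dual in `Cᵗ`.
  have hdual : IsGCProjective R C (M →ₗ[R] C) :=
    hsub.of_injective_pi hC (s := t) (LinearMap.pi fun m => LinearMap.applyₗ (m : M))
      (fun φ ψ hφ => LinearMap.ext_on ht fun m hm => congrFun hφ ⟨m, hm⟩)
  have := hsub.finitePresentation_hom hC hdual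
  obtain ⟨s, t, _, _, j, q, hj, hjq, hext⟩ := h.exists_finite_embedding
  have := Fintype.ofFinite s
  let ev : M →ₗ[R] ((M →ₗ[R] C) →ₗ[R] C) := LinearMap.applyₗ
  suffices hev : Function.Bijective ev from .of_equiv (LinearEquiv.ofBijective ev hev).symm
  constructor
  · rw [injective_iff_map_eq_zero]
    intro m hm
    apply hj
    rw [map_zero]
    ext k
    exact LinearMap.congr_fun hm (LinearMap.proj k ∘ₗ j)
  · intro φ
    -- The point of `Cˢ` that should represent `φ`. Every map `Cˢ → C` is a linear combination of
    -- coordinates, so `φ` is determined by `x`; applied to the coordinates of `q`, this puts `x` in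
    -- the kernel of `q`, which is `M`.
    let x : s → C := fun k => φ (LinearMap.proj k ∘ₗ j)
    have key : ∀ ψ : (s → C) →ₗ[R] C, ψ x = φ (ψ ∘ₗ j) := fun ψ => by
      choose r hr using fun k => hC.eq_smul (ψ ∘ₗ LinearMap.single R (fun _ => C) k)
      have hψ : ∀ y, ψ y = ∑ k, r k • y k := fun y => by
        conv_lhs => rw [← Finset.univ_sum_single y]
        rw [map_sum]
        exact Finset.sum_congr rfl fun k _ => hr k (y k)
      have : ψ ∘ₗ j = ∑ k, r k • (LinearMap.proj k ∘ₗ j) := by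
        ext m
        simp [hψ]
      rw [hψ, this, map_sum]
      simp [x]
    have hqx : q x = 0 := by
      ext l
      refine (key (LinearMap.proj l ∘ₗ q)).trans ?_
      rw [LinearMap.comp_assoc, hjq.linearMap_comp_eq_zero, LinearMap.comp_zero, map_zero]
      rfl
    obtain ⟨m, hm⟩ := (hjq x).mp hqx
    refine ⟨m, ?_⟩
    ext θ
    obtain ⟨ψ, rfl⟩ := hext θ
    rw [← key, ← hm]
    rfl

/-- Finite submodules of finite free modules are `G_C`-projective. -/
theorem FGSubmodulesGCProjective.of_injective_free (hC : IsSemidualizing R C)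
    (hsub : FGSubmodulesGCProjective R C) {N : Type u} [AddCommGroup N] [Module R N]
    [Module.Finite R N] {s : Type u} [Finite s] (i : N →ₗ[R] (s → R))
    (hi : Function.Injective i) : IsGCProjective R C N := by
  have := hC.finite
  obtain ⟨t, ht⟩ := (Module.Finite.fg_top : (⊤ : Submodule R C).FG)
  -- Multiply each coordinate by the generators of `C`; injectivity is faithfulness of `C`.
  let f : (s → R) →ₗ[R] (s × t → C) :=
    LinearMap.pi fun k => (LinearMap.toSpanSingleton R C k.2) ∘ₗ LinearMap.proj k.1
  have hf : Function.Injective f := by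
    intro x y hxy
    ext k
    apply hC.bijective_homothety.1
    exact LinearMap.ext_on ht fun c hc => congrFun hxy (k, ⟨c, hc⟩)
  exact hsub.of_injective_pi hC (f ∘ₗ i) (hf.comp hi)

theorem FGSubmodulesGCProjective.of_ideal (hC : IsSemidualizing R C)
    (hsub : FGSubmodulesGCProjective R C) (I : Ideal R) (hI : I.FG) : IsGCProjective R C I := by
  have : Module.Finite R I := Module.Finite.iff_fg.mpr hI
  refine hsub.of_injective_free hC (s := PUnit) (LinearMap.pi fun _ => I.subtype) ?_
  intro x y h
  exact Subtype.ext (congrFun h PUnit.unit)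

theorem FGSubmodulesGCProjective.isCoherent (hC : IsSemidualizing R C)
    (hsub : FGSubmodulesGCProjective R C) : IsCoherent R := by
  intro I hI
  have : Module.Finite R I := Module.Finite.iff_fg.mpr hI
  exact hsub.finitePresentation hC (hsub.of_ideal hC I hI)

end

/-! ### The evaluation isomorphism `M ⊗ Hom(A, B) ≅ Hom(Hom(M, A), B)` -/

section HomEvaluation

variable {R : Type u} [CommRing R]

/-- The map `M ⊗ Hom(A, B) → Hom(Hom(M, A), B)` sending `m ⊗ g` to `h ↦ g (h m)`. -/
noncomputable def homEval (R : Type u) [CommRing R] (M A B : Type*) [AddCommGroup M] [Module R M]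
    [AddCommGroup A] [Module R A] [AddCommGroup B] [Module R B] :
    M ⊗[R] (A →ₗ[R] B) →ₗ[R] ((M →ₗ[R] A) →ₗ[R] B) :=
  TensorProduct.lift (LinearMap.mk₂ R (fun m g => g ∘ₗ LinearMap.applyₗ m)
    (fun _ _ _ => by ext; simp) (fun _ _ _ => by ext; simp)
    (fun _ _ _ => by ext; simp) (fun _ _ _ => by ext; simp))

@[simp]
theorem homEval_tmul {M A B : Type*} [AddCommGroup M] [Module R M]
    [AddCommGroup A] [Module R A] [AddCommGroup B] [Module R B] (m : M) (g : A →ₗ[R] B)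
    (h : M →ₗ[R] A) : homEval R M A B (m ⊗ₜ g) h = g (h m) := rfl

theorem homEval_naturality {M N A B : Type*} [AddCommGroup M] [Module R M] [AddCommGroup N]
    [Module R N] [AddCommGroup A] [Module R A] [AddCommGroup B] [Module R B] (f : M →ₗ[R] N) :
    homEval R N A B ∘ₗ f.rTensor (A →ₗ[R] B) = (f.lcomp R A).lcomp R B ∘ₗ homEval R M A B := by
  ext m g h
  rfl

theorem homEval_bijective_pi (A B : Type*) [AddCommGroup A] [Module R A] [AddCommGroup B]
    [Module R B] (n : ℕ) : Function.Bijective (homEval R (Fin n → R) A B) := by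
  let inv : (((Fin n → R) →ₗ[R] A) →ₗ[R] B) →ₗ[R] (Fin n → R) ⊗[R] (A →ₗ[R] B) :=
    ∑ i, TensorProduct.mk R (Fin n → R) (A →ₗ[R] B) (Pi.single i 1) ∘ₗ
      LinearMap.lcomp R B (LinearMap.smulRightₗ (LinearMap.proj i))
  have h₁ : inv ∘ₗ homEval R (Fin n → R) A B = LinearMap.id := by
    refine TensorProduct.ext' fun r g => ?_
    have : ∀ i, LinearMap.lcomp R B (LinearMap.smulRightₗ (LinearMap.proj i : (Fin n → R) →ₗ[R] R))
        (homEval R (Fin n → R) A B (r ⊗ₜ g)) = r i • g := fun i => by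
      ext a
      simp
    simp only [inv, LinearMap.comp_apply, LinearMap.sum_apply, this, TensorProduct.mk_apply,
      LinearMap.id_apply, ← TensorProduct.smul_tmul, ← TensorProduct.sum_tmul]
    congr 1
    exact (pi_eq_sum_univ' r).symm
  have h₂ : homEval R (Fin n → R) A B ∘ₗ inv = LinearMap.id := by
    refine LinearMap.ext fun Φ => LinearMap.ext fun h => ?_
    have hinv : inv Φ = ∑ i, Pi.single i 1 ⊗ₜ
        (Φ ∘ₗ LinearMap.smulRightₗ (LinearMap.proj i : (Fin n → R) →ₗ[R] R)) := by
      simp only [inv, LinearMap.sum_apply]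
      rfl
    rw [LinearMap.comp_apply, hinv, map_sum, LinearMap.sum_apply]
    simp only [homEval_tmul, LinearMap.comp_apply]
    rw [← map_sum]
    refine congrArg Φ (LinearMap.pi_ext' fun i => ?_)
    ext
    simp [Pi.single_apply]
  exact ⟨Function.LeftInverse.injective (LinearMap.congr_fun h₁),
    Function.RightInverse.surjective (LinearMap.congr_fun h₂)⟩

theorem exact_lcomp_of_injective {A B D Q : Type u} [AddCommGroup A] [Module R A]
    [AddCommGroup B] [Module R B] [AddCommGroup D] [Module R D] [AddCommGroup Q] [Module R Q]
    [hQ : Module.Injective R Q] {f : A →ₗ[R] B} {g : B →ₗ[R] D} (h : Function.Exact f g) :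
    Function.Exact (g.lcomp R Q) (f.lcomp R Q) := by
  have h' : Function.Exact f g.rangeRestrict := by
    rw [LinearMap.exact_iff, LinearMap.ker_rangeRestrict]
    exact h.linearMap_ker_eq
  intro φ
  rw [LinearMap.exact_lcomp_of_exact_of_surjective Q h' (LinearMap.surjective_rangeRestrict g) φ]
  constructor
  · rintro ⟨ψ, rfl⟩
    obtain ⟨θ, hθ⟩ := hQ.out (LinearMap.range g).subtype (Submodule.subtype_injective _) ψ
    exact ⟨θ, by ext b; exact hθ (g.rangeRestrict b)⟩
  · rintro ⟨ψ, rfl⟩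
    exact ⟨ψ ∘ₗ (LinearMap.range g).subtype, rfl⟩

/-- Both sides are right exact in `M` because `B` is injective, so a finite free presentation
reduces the claim to `Rⁿ`. -/
theorem homEval_bijective (M A B : Type u) [AddCommGroup M] [Module R M] [AddCommGroup A]
    [Module R A] [AddCommGroup B] [Module R B] [Module.FinitePresentation R M]
    [hB : Module.Injective R B] : Function.Bijective (homEval R M A B) := by
  obtain ⟨n, m, f, g, hf, hgf⟩ := Module.FinitePresentation.exists_fin' R M
  have hinj : Function.Injective (f.lcomp R A) := LinearMap.lcomp_injective_of_surjective f hf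
  have hex := LinearMap.exact_lcomp_of_exact_of_surjective A hgf hf
  have hsurj : Function.Surjective ((f.lcomp R A).lcomp R B) := fun φ => by
    obtain ⟨ψ, hψ⟩ := hB.out (f.lcomp R A) hinj φ
    exact ⟨ψ, LinearMap.ext hψ⟩
  have hex' : Function.Exact ((g.lcomp R A).lcomp R B) ((f.lcomp R A).lcomp R B) := by
    exact exact_lcomp_of_injective hex
  exact LinearMap.bijective_of_surjective_of_bijective_of_right_exact _ _ _ _ _ _ _
    (homEval_naturality g).symm (homEval_naturality f).symm (rTensor_exact _ hgf hf) hex'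
    (homEval_bijective_pi A B m).2 (homEval_bijective_pi A B n)
    (LinearMap.rTensor_surjective _ hf) hsurj

/-- If maps into `A` extend along `f`, then `f ⊗ Hom(A, Q)` is injective, for `Q` injective and a
finitely presented source of `f`. -/
theorem rTensor_hom_injective {M N A Q : Type u} [AddCommGroup M] [Module R M] [AddCommGroup N]
    [Module R N] [AddCommGroup A] [Module R A] [AddCommGroup Q] [Module R Q]
    [Module.FinitePresentation R M] [Module.Injective R Q] (f : M →ₗ[R] N)
    (h : ∀ φ : M →ₗ[R] A, ∃ ψ : N →ₗ[R] A, ψ ∘ₗ f = φ) :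
    Function.Injective (f.rTensor (A →ₗ[R] Q)) := by
  have h1 : Function.Injective (homEval R N A Q ∘ₗ f.rTensor (A →ₗ[R] Q)) := by
    rw [homEval_naturality]
    exact (LinearMap.lcomp_injective_of_surjective (f.lcomp R A) h).comp
      (homEval_bijective M A Q).1
  exact Function.Injective.of_comp h1

theorem lTensor_hom_injective {M N A Q : Type u} [AddCommGroup M] [Module R M] [AddCommGroup N]
    [Module R N] [AddCommGroup A] [Module R A] [AddCommGroup Q] [Module R Q]
    [Module.FinitePresentation R M] [Module.Injective R Q] (f : M →ₗ[R] N)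
    (h : ∀ φ : M →ₗ[R] A, ∃ ψ : N →ₗ[R] A, ψ ∘ₗ f = φ) :
    Function.Injective (f.lTensor (A →ₗ[R] Q)) :=
  (LinearMap.lTensor_inj_iff_rTensor_inj _ f).mpr (rTensor_hom_injective f h)

end HomEvaluation

/-! ### Duality with the character module -/

section Dual

variable {R : Type u} [CommRing R]

variable (R) in
/-- The dual with respect to the injective cogenerator `CharacterModule R`. -/
abbrev InjDual (M : Type u) [AddCommGroup M] [Module R M] : Type u := M →ₗ[R] CharacterModule R

instance injective_characterModule_self : Module.Injective R (CharacterModule R) :=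
  Module.Flat.iff_characterModule_injective.mp inferInstance

theorem eq_zero_of_injDual {M : Type u} [AddCommGroup M] [Module R M] {x : M}
    (h : ∀ φ : InjDual R M, φ x = 0) : x = 0 := by
  refine CharacterModule.eq_zero_of_character_apply fun c => ?_
  have := h (CharacterModule.curry
    (CharacterModule.dual (TensorProduct.rid R M).toLinearMap c))
  have h1 : c (TensorProduct.rid R M (x ⊗ₜ 1)) = 0 := DFunLike.congr_fun this 1
  simpa using h1

/-- Maps into the dual of `J` are maps from `J ⊗ -` into an injective module. -/
theorem extend_injDual {X Y J : Type u} [AddCommGroup X] [Module R X] [AddCommGroup Y]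
    [Module R Y] [AddCommGroup J] [Module R J] {f : X →ₗ[R] Y}
    (hf : Function.Injective (f.lTensor J)) (g : X →ₗ[R] InjDual R J) :
    ∃ h : Y →ₗ[R] InjDual R J, h ∘ₗ f = g := by
  obtain ⟨k, hk⟩ := Module.Injective.out (Q := CharacterModule R) (f.lTensor J) hf
    (TensorProduct.lift g.flip)
  refine ⟨(TensorProduct.curry k).flip, ?_⟩
  ext1 x
  ext1 j
  exact hk (j ⊗ₜ x)

theorem injective_injDual (F : Type u) [AddCommGroup F] [Module R F] [Module.Flat R F] :
    Module.Injective R (InjDual R F) where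
  out X Y _ _ _ _ f hf g := by
    obtain ⟨h, hh⟩ := extend_injDual (Module.Flat.lTensor_preserves_injective_linearMap f hf) g
    exact ⟨h, LinearMap.congr_fun hh⟩

/-- Coherence makes finitely generated ideals finitely presented, so the evaluation isomorphism
turns extension of maps `I → E` into injectivity of `I ⊗ Hom(E, R⁺) → R ⊗ Hom(E, R⁺)`. -/
theorem flat_injDual (hR : IsCoherent R) (E : Type u) [AddCommGroup E] [Module R E]
    [hE : Module.Injective R E] : Module.Flat R (InjDual R E) := by
  rw [Module.Flat.iff_rTensor_injective]
  intro I hI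
  have := hR I hI
  refine rTensor_hom_injective I.subtype fun φ => ?_
  obtain ⟨ψ, hψ⟩ := hE.out I.subtype (Submodule.subtype_injective _) φ
  exact ⟨ψ, LinearMap.ext hψ⟩

/-- The evaluation map into the double dual. -/
noncomputable def biEval (R : Type u) [CommRing R] (Y : Type u) [AddCommGroup Y] [Module R Y] :
    Y →ₗ[R] InjDual R (InjDual R Y) :=
  LinearMap.applyₗ

/-- The evaluation map into the double dual is pure. -/
theorem lTensor_biEval_injective (Y J : Type u) [AddCommGroup Y] [Module R Y] [AddCommGroup J]
    [Module R J] : Function.Injective ((biEval R Y).lTensor J) := by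
  rw [injective_iff_map_eq_zero]
  intro t ht
  refine eq_zero_of_injDual (R := R) fun φ => ?_
  -- A character-module-valued map on `J ⊗ Y` can be recovered after passing to the double dual of
  -- `Y`, so no element is killed.
  have key : ∀ t, homEval R J (InjDual R Y) (CharacterModule R) ((biEval R Y).lTensor J t)
      (TensorProduct.curry φ) = φ t := fun t => by
    induction t with
    | zero => simp
    | add x y hx hy => rw [map_add, map_add, LinearMap.add_apply, hx, hy, map_add]
    | tmul j y => rfl
  rw [← key, ht, map_zero, LinearMap.zero_apply]

/-- A quotient of a flat module by a pure submodule is flat. -/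
theorem flat_of_pure {F G D : Type u} [AddCommGroup F] [Module R F] [AddCommGroup G] [Module R G]
    [AddCommGroup D] [Module R D] [Module.Flat R G] {f : F →ₗ[R] G} {g : G →ₗ[R] D}
    (hfg : Function.Exact f g) (hg : Function.Surjective g)
    (hf : ∀ (J : Type u) [AddCommGroup J] [Module R J], Function.Injective (f.lTensor J)) :
    Module.Flat R D := by
  rw [Module.Flat.iff_rTensor_injective']
  intro I
  rw [injective_iff_map_eq_zero]
  intro d hd
  obtain ⟨y, rfl⟩ := LinearMap.lTensor_surjective I hg d
  have hy : g.lTensor R (I.subtype.rTensor G y) = 0 := by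
    rw [← hd, ← LinearMap.comp_apply, ← LinearMap.comp_apply, LinearMap.lTensor_comp_rTensor,
      LinearMap.rTensor_comp_lTensor]
  obtain ⟨z, hz⟩ := (lTensor_exact R hfg hg _).mp hy
  have hI := LinearMap.exact_subtype_mkQ I
  have hI' := Submodule.mkQ_surjective I
  -- Purity is used against `R ⧸ I`: `z` lies in `I G`, hence in `I F`.
  have hz' : (Submodule.mkQ I).rTensor F z = 0 := by
    apply hf (R ⧸ I)
    rw [map_zero, ← LinearMap.comp_apply, LinearMap.lTensor_comp_rTensor,
      ← LinearMap.rTensor_comp_lTensor, LinearMap.comp_apply, hz]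
    exact (rTensor_exact G hI hI').apply_apply_eq_zero y
  obtain ⟨w, rfl⟩ := (rTensor_exact F hI hI' _).mp hz'
  have : f.lTensor I w = y := by
    apply Module.Flat.rTensor_preserves_injective_linearMap (M := G) I.subtype
      (Submodule.subtype_injective _)
    rw [← hz, ← LinearMap.comp_apply, ← LinearMap.comp_apply, LinearMap.lTensor_comp_rTensor,
      LinearMap.rTensor_comp_lTensor]
  rw [← this]
  exact (lTensor_exact I hfg hg).apply_apply_eq_zero w

end Dual

/-! ### `Tor₁` through presentations -/

section TorVanishing

variable {R : Type u} [CommRing R]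

theorem lTensor_rTensor_apply {T T' A B : Type*} [AddCommGroup T] [Module R T] [AddCommGroup T']
    [Module R T'] [AddCommGroup A] [Module R A] [AddCommGroup B] [Module R B] (t : T →ₗ[R] T')
    (f : A →ₗ[R] B) (x : T ⊗[R] A) :
    f.lTensor T' (t.rTensor A x) = t.rTensor B (f.lTensor T x) := by
  rw [← LinearMap.comp_apply, ← LinearMap.comp_apply, LinearMap.lTensor_comp_rTensor,
    LinearMap.rTensor_comp_lTensor]

variable {T₁ T₀ J A B D : Type u} [AddCommGroup T₁] [Module R T₁] [AddCommGroup T₀] [Module R T₀]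
  [AddCommGroup J] [Module R J] [AddCommGroup A] [Module R A] [AddCommGroup B] [Module R B]
  [AddCommGroup D] [Module R D] {t : T₁ →ₗ[R] T₀} {p : T₀ →ₗ[R] J} {f : A →ₗ[R] B}
  {g : B →ₗ[R] D}

/-- One half of the balance of `Tor₁`: vanishing seen on a presentation of `J` is seen on a
presentation of `D`. `rTensor_injective_quotient` is the other half. -/
theorem lTensor_injective_of_rTensor_injective [Module.Flat R T₀] (htp : Function.Exact t p)
    (hp : Function.Surjective p) (hf : Function.Injective f) (hfg : Function.Exact f g)
    (hg : Function.Surjective g) (h : Function.Injective (t.rTensor D)) :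
    Function.Injective (f.lTensor J) := by
  rw [injective_iff_map_eq_zero]
  intro x hx
  obtain ⟨y, rfl⟩ := LinearMap.rTensor_surjective A hp x
  rw [lTensor_rTensor_apply] at hx
  obtain ⟨s, hs⟩ := (rTensor_exact B htp hp _).mp hx
  have hs' : g.lTensor T₁ s = 0 := by
    apply h
    rw [← lTensor_rTensor_apply, hs, map_zero]
    exact (lTensor_exact T₀ hfg hg).apply_apply_eq_zero y
  obtain ⟨a, rfl⟩ := (lTensor_exact T₁ hfg hg _).mp hs'
  have : t.rTensor A a = y := by
    apply Module.Flat.lTensor_preserves_injective_linearMap (M := T₀) f hf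
    rw [lTensor_rTensor_apply, hs]
  rw [← this]
  exact (rTensor_exact A htp hp).apply_apply_eq_zero a

theorem rTensor_injective_quotient (htp : Function.Exact t p)
    (hp : Function.Surjective p) (hfg : Function.Exact f g)
    (hg : Function.Surjective g) (h : Function.Injective (f.lTensor J))
    (hB : Function.Injective (t.rTensor B)) : Function.Injective (t.rTensor D) := by
  rw [injective_iff_map_eq_zero]
  intro d hd
  obtain ⟨b, rfl⟩ := LinearMap.lTensor_surjective T₁ hg d
  rw [← lTensor_rTensor_apply] at hd
  obtain ⟨a, ha⟩ := (lTensor_exact T₀ hfg hg _).mp hd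
  have ha' : p.rTensor A a = 0 := by
    apply h
    rw [lTensor_rTensor_apply, ha, map_zero]
    exact (rTensor_exact B htp hp).apply_apply_eq_zero b
  obtain ⟨a', rfl⟩ := (rTensor_exact A htp hp _).mp ha'
  have : f.lTensor T₁ a' = b := by
    apply hB
    rw [← lTensor_rTensor_apply, ha]
  rw [← this]
  exact (lTensor_exact T₁ hfg hg).apply_apply_eq_zero a'

theorem rTensor_injective_extension [Module.Flat R T₀]
    (hf : Function.Injective f) (hfg : Function.Exact f g)
    (hg : Function.Surjective g) (hA : Function.Injective (t.rTensor A))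
    (hD : Function.Injective (t.rTensor D)) : Function.Injective (t.rTensor B) := by
  rw [injective_iff_map_eq_zero]
  intro b hb
  have : g.lTensor T₁ b = 0 := by
    apply hD
    rw [← lTensor_rTensor_apply, hb, map_zero, map_zero]
  obtain ⟨a, rfl⟩ := (lTensor_exact T₁ hfg hg _).mp this
  have ha : a = 0 := by
    apply hA
    apply Module.Flat.lTensor_preserves_injective_linearMap (M := T₀) f hf
    rw [lTensor_rTensor_apply, hb, map_zero, map_zero]
  rw [ha, map_zero]

/-- A flat syzygy kills `Tor₂`, so `Tor₁` preserves injections. -/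
theorem rTensor_injective_submodule [Module.Flat R T₁] (hf : Function.Injective f)
    (hB : Function.Injective (t.rTensor B)) : Function.Injective (t.rTensor A) := by
  rw [injective_iff_map_eq_zero]
  intro a ha
  apply Module.Flat.lTensor_preserves_injective_linearMap (M := T₁) f hf
  apply hB
  rw [← lTensor_rTensor_apply, ha, map_zero, map_zero, map_zero]

/-- The composite `T₁ ⊗ I → T₀ ⊗ I → T₀ ⊗ R` is injective and factors through `T₁ ⊗ R`. -/
theorem flat_of_rTensor_injective [Module.Flat R T₀]
    (h : ∀ I : Ideal R, I.FG → Function.Injective (t.rTensor I)) : Module.Flat R T₁ := by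
  rw [Module.Flat.iff_lTensor_injective]
  intro I hI
  rw [injective_iff_map_eq_zero]
  intro x hx
  apply h I hI
  apply Module.Flat.lTensor_preserves_injective_linearMap (M := T₀) I.subtype
    (Submodule.subtype_injective _)
  rw [lTensor_rTensor_apply, hx, map_zero, map_zero, map_zero]

variable (R) in
/-- The free module on the elements of `J`. -/
noncomputable def freeOn (J : Type u) : ModuleCat.{u} R := ModuleCat.of R (J →₀ R)

instance (J : Type u) : Module.Free R (freeOn R J) := inferInstanceAs (Module.Free R (J →₀ R))

variable (R) in
/-- The canonical free cover of a module. -/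
noncomputable def freeCover (J : Type u) [AddCommGroup J] [Module R J] : freeOn R J →ₗ[R] J :=
  Finsupp.linearCombination R id

theorem freeCover_surjective (J : Type u) [AddCommGroup J] [Module R J] :
    Function.Surjective (freeCover R J) :=
  Finsupp.linearCombination_id_surjective R J

variable (R) in
/-- The first syzygy of a module in its canonical free cover. -/
noncomputable def freeKer (J : Type u) [AddCommGroup J] [Module R J] : ModuleCat.{u} R :=
  ModuleCat.of R (LinearMap.ker (freeCover R J))

variable (R) in
/-- The inclusion of the first syzygy. -/
noncomputable def freeKerIncl (J : Type u) [AddCommGroup J] [Module R J] :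
    freeKer R J →ₗ[R] freeOn R J :=
  (LinearMap.ker (freeCover R J)).subtype

theorem freeKerIncl_injective (J : Type u) [AddCommGroup J] [Module R J] :
    Function.Injective (freeKerIncl R J) :=
  Submodule.subtype_injective _

theorem exact_freeCover (J : Type u) [AddCommGroup J] [Module R J] :
    Function.Exact (freeKerIncl R J) (freeCover R J) :=
  LinearMap.exact_subtype_ker_map (freeCover R J)

variable (R) in
/-- Vanishing of `Tor₁(J, D)`. -/
def TorVanishes (J D : Type u) [AddCommGroup J] [Module R J] [AddCommGroup D] [Module R D] :
    Prop :=
  Function.Injective ((freeKerIncl R J).rTensor D)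

theorem TorVanishes.of_flat (J D : Type u) [AddCommGroup J] [Module R J] [AddCommGroup D]
    [Module R D] [Module.Flat R D] : TorVanishes R J D :=
  Module.Flat.rTensor_preserves_injective_linearMap _ (freeKerIncl_injective J)

theorem TorVanishes.tensor_flat {J C : Type u} [AddCommGroup J] [Module R J] [AddCommGroup C]
    [Module R C] (h : TorVanishes R J C) (F : Type u) [AddCommGroup F] [Module R F]
    [Module.Flat R F] : TorVanishes R J (C ⊗[R] F) := by
  have h1 := Module.Flat.rTensor_preserves_injective_linearMap (M := F) _ h
  have h2 : (TensorProduct.assoc R _ C F).toLinearMap ∘ₗ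
      (((freeKerIncl R J).rTensor C).rTensor F) =
      (freeKerIncl R J).rTensor (C ⊗[R] F) ∘ₗ (TensorProduct.assoc R _ C F).toLinearMap :=
    TensorProduct.ext_threefold fun x c y => rfl
  have h3 := (TensorProduct.assoc R (freeOn R J) C F).injective.comp h1
  rw [← LinearEquiv.coe_coe, ← LinearMap.coe_comp, h2] at h3
  exact (Function.Injective.of_comp_iff' _ (TensorProduct.assoc R _ C F).bijective).mp h3

/-- If `Tor₁(J, I)` vanishes for all finitely generated ideals `I`, then `J` has flat dimension at
most one. -/
theorem flat_freeKer (J : Type u) [AddCommGroup J] [Module R J]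
    (h : ∀ I : Ideal R, I.FG → TorVanishes R J I) : Module.Flat R (freeKer R J) :=
  flat_of_rTensor_injective h

end TorVanishing

/-! ### Flat dimension of `Hom(C, E)` -/

section

variable {R : Type u} [CommRing R] {C : Type u} [AddCommGroup C] [Module R C]

theorem IsSemidualizing.finitePresentation (hC : IsSemidualizing R C) :
    Module.FinitePresentation R C := by
  obtain ⟨X, hX⟩ := hC.exists_resolution
  have h0 := hX 0
  have h1 := (hX 1).1
  have := h0.1
  have := h0.2
  have := Module.finitePresentation_of_projective R (X.obj 0)
  refine Module.finitePresentation_of_surjective X.ε X.surjective_ε ?_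
  rw [X.exact_ε.linearMap_ker_eq]
  exact Module.Finite.iff_fg.mp (Module.Finite.range (X.d 0))

/-- By the evaluation isomorphism this is dual to `Ext¹(C, C) = 0`, the first syzygy of `C` being
finitely presented. -/
theorem IsSemidualizing.torVanishes_self (hC : IsSemidualizing R C) (E : Type u) [AddCommGroup E]
    [Module R E] [Module.Injective R E] : TorVanishes R (C →ₗ[R] E) C := by
  obtain ⟨X, hX⟩ := hC.exists_resolution
  have hfin n := (hX n).1
  have hproj n := (hX n).2
  have := Module.finitePresentation_of_projective R (X.obj 1)
  have : Module.FinitePresentation R (LinearMap.range (X.d 0)) := by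
    refine Module.finitePresentation_of_surjective (X.d 0).rangeRestrict
      (LinearMap.surjective_rangeRestrict _) ?_
    rw [LinearMap.ker_rangeRestrict, (X.exact_d 0).linearMap_ker_eq]
    exact Module.Finite.iff_fg.mp (Module.Finite.range (X.d 1))
  have hex : Function.Exact (LinearMap.range (X.d 0)).subtype X.ε := by
    rw [LinearMap.exact_iff, Submodule.range_subtype]
    exact X.exact_ε.linearMap_ker_eq
  exact rTensor_injective_quotient (exact_freeCover _) (freeCover_surjective _) hex X.surjective_ε
    (lTensor_hom_injective _ (X.extend_of_ext hproj hC.ext_eq_zero 0)) (TorVanishes.of_flat _ _)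

theorem FGSubmodulesGCProjective.torVanishes_ideal (hC : IsSemidualizing R C)
    (hsub : FGSubmodulesGCProjective R C) (E : Type u) [AddCommGroup E]
    [Module R E] [Module.Injective R E] (I : Ideal R) (hI : I.FG) :
    TorVanishes R (C →ₗ[R] E) I := by
  have : Module.Finite R I := Module.Finite.iff_fg.mpr hI
  have : Module.FinitePresentation R I := hsub.isCoherent hC I hI
  obtain ⟨s, hs⟩ := (Module.Finite.fg_top : (⊤ : Submodule R I).FG)
  let q : (s → R) →ₗ[R] I := Fintype.linearCombination R fun x => (x : I)
  have hq : Function.Surjective q := by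
    rw [← LinearMap.range_eq_top, Fintype.range_linearCombination, ← hs]
    simp
  have : Module.Finite R (LinearMap.ker q) :=
    Module.Finite.iff_fg.mpr (Module.FinitePresentation.fg_ker q hq)
  -- The evaluation isomorphism needs a finitely presented syzygy. The cover from the
  -- `G_C`-projective complex need not be finite, so its extension property is transferred to `q`.
  have : Module.FinitePresentation R (LinearMap.ker q) := hsub.finitePresentation hC
    (hsub.of_injective_free hC (LinearMap.ker q).subtype (Submodule.subtype_injective _))
  obtain ⟨P, p, _, hp, hext⟩ := (hsub.of_ideal hC I hI).exists_cover
  exact rTensor_injective_quotient (exact_freeCover _) (freeCover_surjective _)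
    (LinearMap.exact_subtype_ker_map q) hq
    (lTensor_hom_injective _ (extend_of_projective_cover p q hp hq hext))
    (TorVanishes.of_flat _ _)

/-- The homological properties of `C` used to construct `G_C`-flat coresolutions. -/
structure HomFlatDimLEOne (R : Type u) [CommRing R] (C : Type u) [AddCommGroup C]
    [Module R C] : Prop where
  isCoherent : IsCoherent R
  finitePresentation : Module.FinitePresentation R C
  torVanishes_self (E : Type u) [AddCommGroup E] [Module R E] [Module.Injective R E] :
    TorVanishes R (C →ₗ[R] E) C
  /-- `Hom(C, E)` has flat dimension at most one. -/
  flat_freeKer (E : Type u) [AddCommGroup E] [Module R E] [Module.Injective R E] :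
    Module.Flat R (freeKer R (C →ₗ[R] E))

theorem FGSubmodulesGCProjective.homFlatDimLEOne (hC : IsSemidualizing R C)
    (hsub : FGSubmodulesGCProjective R C) : HomFlatDimLEOne R C where
  isCoherent := hsub.isCoherent hC
  finitePresentation := hC.finitePresentation
  torVanishes_self E _ _ _ := hC.torVanishes_self E
  flat_freeKer E _ _ _ := flat_freeKer _ (hsub.torVanishes_ideal hC E)

end

/-! ### The class `HomTorVanishes` and its relatively injective modules -/

section

variable {R : Type u} [CommRing R] {C : Type u} [AddCommGroup C] [Module R C]
  {A B D : Type u} [AddCommGroup A] [Module R A] [AddCommGroup B] [Module R B]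
  [AddCommGroup D] [Module R D] {f : A →ₗ[R] B} {g : B →ₗ[R] D}

variable (R C) in
/-- Vanishing of `Tor₁(Hom(C, E), D)` for all injective modules `E`. -/
def HomTorVanishes (D : Type u) [AddCommGroup D] [Module R D] : Prop :=
  ∀ (E : Type u) [AddCommGroup E] [Module R E] [Module.Injective R E],
    TorVanishes R (C →ₗ[R] E) D

theorem HomTorVanishes.of_flat (D : Type u) [AddCommGroup D] [Module R D] [Module.Flat R D] :
    HomTorVanishes R C D :=
  fun _ _ _ _ => TorVanishes.of_flat _ _

theorem HomTorVanishes.of_injective (h : HomFlatDimLEOne R C) (hB : HomTorVanishes R C B)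
    (hf : Function.Injective f) : HomTorVanishes R C A := by
  intro E _ _ _
  have := h.flat_freeKer E
  exact rTensor_injective_submodule hf (hB E)

theorem HomTorVanishes.extension (hf : Function.Injective f) (hfg : Function.Exact f g)
    (hg : Function.Surjective g) (hA : HomTorVanishes R C A) (hD : HomTorVanishes R C D) :
    HomTorVanishes R C B :=
  fun E _ _ _ => rTensor_injective_extension hf hfg hg (hA E) (hD E)

theorem HomTorVanishes.lTensor_injective (hf : Function.Injective f) (hfg : Function.Exact f g)
    (hg : Function.Surjective g) (hD : HomTorVanishes R C D) (E : Type u) [AddCommGroup E]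
    [Module R E] [Module.Injective R E] : Function.Injective (f.lTensor (C →ₗ[R] E)) :=
  lTensor_injective_of_rTensor_injective (exact_freeCover _) (freeCover_surjective _) hf hfg hg
    (hD E)

theorem HomFlatDimLEOne.homTorVanishes_tensor (h : HomFlatDimLEOne R C) (F : Type u)
    [AddCommGroup F] [Module R F] [Module.Flat R F] : HomTorVanishes R C (C ⊗[R] F) :=
  fun E _ _ _ => (h.torVanishes_self E).tensor_flat F

variable (R C) in
/-- Modules of the form `Hom(Hom(C, E), CharacterModule R)` with `E` injective. -/
def IsDualHom (Y : Type u) [AddCommGroup Y] [Module R Y] : Prop :=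
  ∃ E : ModuleCat.{u} R, Module.Injective R E ∧ Nonempty (Y ≃ₗ[R] InjDual R (C →ₗ[R] E))

/-- The evaluation isomorphism for the finitely presented module `C`. -/
theorem HomFlatDimLEOne.isDualHom_tensor (h : HomFlatDimLEOne R C) (E : Type u)
    [AddCommGroup E] [Module R E] [hE : Module.Injective R E] :
    IsDualHom R C (C ⊗[R] InjDual R E) := by
  have := h.finitePresentation
  exact ⟨ModuleCat.of R E, hE,
    ⟨LinearEquiv.ofBijective (homEval R C E (CharacterModule R)) (homEval_bijective C E _)⟩⟩

theorem IsDualHom.exists_equiv_tensor {Y : Type u} [AddCommGroup Y] [Module R Y]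
    (hY : IsDualHom R C Y) (h : HomFlatDimLEOne R C) :
    ∃ F : ModuleCat.{u} R, Module.Flat R F ∧ Nonempty (Y ≃ₗ[R] C ⊗[R] F) := by
  obtain ⟨E, hE, ⟨e⟩⟩ := hY
  have := h.finitePresentation
  exact ⟨ModuleCat.of R (InjDual R E), flat_injDual h.isCoherent E,
    ⟨e.trans (LinearEquiv.ofBijective (homEval R C E (CharacterModule R))
      (homEval_bijective C E _)).symm⟩⟩

theorem IsDualHom.prod {Y Z : Type u} [AddCommGroup Y] [Module R Y] [AddCommGroup Z] [Module R Z]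
    (hY : IsDualHom R C Y) (hZ : IsDualHom R C Z) : IsDualHom R C (Y × Z) := by
  obtain ⟨E, hE, ⟨e⟩⟩ := hY
  obtain ⟨E', hE', ⟨e'⟩⟩ := hZ
  refine ⟨ModuleCat.of R (E × E'), ⟨fun X Y _ _ _ _ f hf g => ?_⟩, ⟨?_⟩⟩
  · obtain ⟨a, ha⟩ := hE.out f hf (LinearMap.fst R E E' ∘ₗ g)
    obtain ⟨b, hb⟩ := hE'.out f hf (LinearMap.snd R E E' ∘ₗ g)
    exact ⟨a.prod b, fun x => Prod.ext (ha x) (hb x)⟩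
  · exact (e.prodCongr e').trans ((LinearMap.coprodEquiv R).trans
      (LinearEquiv.congrLeft (CharacterModule R) R (LinearMap.prodEquiv R)))

/-- Relative injectivity: `Tor₁(Hom(C, E), D) = 0` keeps `f` injective after tensoring with `Hom(C,
E)`, and maps then extend into its dual. -/
theorem IsDualHom.extend {Y : Type u} [AddCommGroup Y] [Module R Y]
    (hY : IsDualHom R C Y) (hf : Function.Injective f) (hfg : Function.Exact f g)
    (hg : Function.Surjective g) (hD : HomTorVanishes R C D) (φ : A →ₗ[R] Y) :
    ∃ ψ : B →ₗ[R] Y, ψ ∘ₗ f = φ := by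
  obtain ⟨E, hE, ⟨e⟩⟩ := hY
  obtain ⟨ψ, hψ⟩ := extend_injDual (hD.lTensor_injective hf hfg hg E) (e.toLinearMap ∘ₗ φ)
  refine ⟨e.symm.toLinearMap ∘ₗ ψ, ?_⟩
  rw [LinearMap.comp_assoc, hψ, ← LinearMap.comp_assoc]
  ext
  simp

theorem IsDualHom.homTorVanishes {Y : Type u} [AddCommGroup Y] [Module R Y]
    (hY : IsDualHom R C Y) (h : HomFlatDimLEOne R C) : HomTorVanishes R C Y := by
  obtain ⟨F, _, ⟨e⟩⟩ := hY.exists_equiv_tensor h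
  exact (h.homTorVanishes_tensor F).of_injective h e.injective

end

/-! ### Coresolutions by relatively injective duals -/

section Coresolution

variable {R : Type u} [CommRing R] {C : Type u} [AddCommGroup C] [Module R C]

variable (R C) in
/-- Existence of partial coresolutions `0 → D → Y₁ → ⋯ → Yₖ` by modules `Hom(Hom(C, E), -)`, with
cokernel in `HomTorVanishes`. -/
def HasCoresolution : ℕ → ModuleCat.{u} R → Prop
  | 0, D => HomTorVanishes R C D
  | k + 1, D => ∃ (Y Z : ModuleCat.{u} R) (f : D →ₗ[R] Y) (g : Y →ₗ[R] Z), IsDualHom R C Y ∧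
      Function.Injective f ∧ Function.Exact f g ∧ Function.Surjective g ∧ HasCoresolution k Z

theorem HasCoresolution.homTorVanishes (h : HomFlatDimLEOne R C) {k : ℕ} {D : ModuleCat.{u} R}
    (hD : HasCoresolution R C k D) : HomTorVanishes R C D := by
  cases k with
  | zero => exact hD
  | succ k =>
    obtain ⟨Y, Z, f, g, hY, hf, -⟩ := hD
    exact (hY.homTorVanishes h).of_injective h hf

theorem HasCoresolution.of_equiv (h : HomFlatDimLEOne R C) {k : ℕ} {D D' : ModuleCat.{u} R}
    (hD : HasCoresolution R C k D) (e : D' ≃ₗ[R] D) : HasCoresolution R C k D' := by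
  cases k with
  | zero => exact HomTorVanishes.of_injective h hD e.injective
  | succ k =>
    obtain ⟨Y, Z, f, g, hY, hf, hfg, hg, hZ⟩ := hD
    refine ⟨Y, Z, f ∘ₗ e.toLinearMap, g, hY, hf.comp e.injective, fun y => ?_, hg, hZ⟩
    rw [hfg y]
    exact (e.surjective.range_comp f ▸ Iff.rfl)

/-- The horseshoe lemma. Relative injectivity of `Y₁` extends `f₁` to `W`, and the cokernel of `W →
Y₁ × Y₂` is an extension of `Z₂` by `Z₁`. -/
theorem HasCoresolution.extension {k : ℕ} {X W Z : ModuleCat.{u} R} {f : X →ₗ[R] W}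
    {g : W →ₗ[R] Z} (h : HomFlatDimLEOne R C) (hf : Function.Injective f)
    (hfg : Function.Exact f g) (hg : Function.Surjective g) (hX : HasCoresolution R C k X)
    (hZ : HasCoresolution R C k Z) : HasCoresolution R C k W := by
  induction k generalizing X W Z with
  | zero => exact HomTorVanishes.extension hf hfg hg hX hZ
  | succ k ih =>
    have hZ' := hZ.homTorVanishes h
    obtain ⟨Y₁, Z₁, f₁, g₁, hY₁, hf₁, hfg₁, hg₁, hZ₁⟩ := hX
    obtain ⟨Y₂, Z₂, f₂, g₂, hY₂, hf₂, hfg₂, hg₂, hZ₂⟩ := hZ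
    obtain ⟨a, ha⟩ := hY₁.extend hf hfg hg hZ' f₁
    have ha' : ∀ x, a (f x) = f₁ x := LinearMap.congr_fun ha
    let b : W →ₗ[R] Y₁ × Y₂ := a.prod (f₂ ∘ₗ g)
    let π := (LinearMap.range b).mkQ
    have hπ : ∀ y, π y = 0 ↔ ∃ w, b w = y := fun y => by
      rw [Submodule.mkQ_apply, Submodule.Quotient.mk_eq_zero, LinearMap.mem_range]
    have hπs : Function.Surjective π := Submodule.mkQ_surjective _
    obtain ⟨p, hp⟩ := exists_factor_of_surjective (k := π ∘ₗ LinearMap.inl R Y₁ Y₂) hg₁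
      (fun y hy => by
        obtain ⟨x, rfl⟩ := (hfg₁ y).mp hy
        exact (hπ _).mpr ⟨f x, Prod.ext (ha' x) (by simp [b, hfg.apply_apply_eq_zero])⟩)
    obtain ⟨q, hq⟩ := exists_factor_of_surjective (k := g₂ ∘ₗ LinearMap.snd R Y₁ Y₂) hπs
      (fun y hy => by
        obtain ⟨w, rfl⟩ := (hπ y).mp hy
        exact hfg₂.apply_apply_eq_zero (g w))
    refine ⟨ModuleCat.of R (Y₁ × Y₂), ModuleCat.of R ((Y₁ × Y₂) ⧸ LinearMap.range b), b, π,
      hY₁.prod hY₂, ?_, fun y => hπ y, hπs, ih (f := p) (g := q) ?_ ?_ ?_ hZ₁ hZ₂⟩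
    · rw [injective_iff_map_eq_zero]
      intro w hw
      have h1 : a w = 0 := congrArg Prod.fst hw
      have h2 : f₂ (g w) = 0 := congrArg Prod.snd hw
      obtain ⟨x, rfl⟩ := (hfg w).mp (hf₂ (h2.trans (map_zero f₂).symm))
      rw [ha'] at h1
      rw [hf₁ (h1.trans (map_zero f₁).symm), map_zero]
    · rw [injective_iff_map_eq_zero]
      intro z hz
      obtain ⟨y, rfl⟩ := hg₁ z
      rw [hp] at hz
      obtain ⟨w, hw⟩ := (hπ _).mp hz
      have h1 : a w = y := congrArg Prod.fst hw
      have h2 : f₂ (g w) = 0 := congrArg Prod.snd hw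
      obtain ⟨x, rfl⟩ := (hfg w).mp (hf₂ (h2.trans (map_zero f₂).symm))
      rw [← h1, ha']
      exact hfg₁.apply_apply_eq_zero x
    · intro v
      obtain ⟨⟨y₁, y₂⟩, rfl⟩ := hπs v
      rw [hq]
      constructor
      · intro hy
        obtain ⟨z, hz⟩ := (hfg₂ y₂).mp hy
        obtain ⟨w, rfl⟩ := hg z
        refine ⟨g₁ (y₁ - a w), ?_⟩
        rw [hp, LinearMap.comp_apply, ← sub_eq_zero, ← map_sub, hπ]
        refine ⟨-w, Prod.ext ?_ ?_⟩
        · simp [b]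
        · simp [b, hz]
      · rintro ⟨z, hz⟩
        obtain ⟨y, rfl⟩ := hg₁ z
        rw [hp] at hz
        have := congrArg q hz
        rw [LinearMap.comp_apply, hq, hq] at this
        rw [← this]
        exact map_zero g₂
    · intro z
      obtain ⟨y, rfl⟩ := hg₂ z
      exact ⟨π (0, y), hq _⟩

/-- If `0 → K → M → N → 0` and `0 → M → Y → V → 0` are exact, then coresolutions of `N` and `V`
give one of `K`. -/
theorem HasCoresolution.succ_of_exact {k : ℕ} {K M N Y V : ModuleCat.{u} R}
    (h : HomFlatDimLEOne R C) {a : K →ₗ[R] M} {b : M →ₗ[R] N} {c : M →ₗ[R] Y} {d : Y →ₗ[R] V}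
    (ha : Function.Injective a) (hab : Function.Exact a b) (hb : Function.Surjective b)
    (hc : Function.Injective c) (hcd : Function.Exact c d) (hd : Function.Surjective d)
    (hY : IsDualHom R C Y) (hN : HasCoresolution R C k N) (hV : HasCoresolution R C k V) :
    HasCoresolution R C (k + 1) K := by
  let π := (LinearMap.range (c ∘ₗ a)).mkQ
  have hπ : ∀ y, π y = 0 ↔ ∃ x, (c ∘ₗ a) x = y := fun y => by
    rw [Submodule.mkQ_apply, Submodule.Quotient.mk_eq_zero, LinearMap.mem_range]
  have hπs : Function.Surjective π := Submodule.mkQ_surjective _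
  obtain ⟨p, hp⟩ := exists_factor_of_surjective (k := π ∘ₗ c) hb (fun m hm => by
    obtain ⟨x, rfl⟩ := (hab m).mp hm
    exact (hπ _).mpr ⟨x, rfl⟩)
  obtain ⟨q, hq⟩ := exists_factor_of_surjective (k := d) hπs (fun y hy => by
    obtain ⟨x, rfl⟩ := (hπ y).mp hy
    exact hcd.apply_apply_eq_zero (a x))
  -- The quotient `Y / K` is an extension of `V = Y / M` by `N = M / K`.
  refine ⟨Y, ModuleCat.of R (Y ⧸ LinearMap.range (c ∘ₗ a)), c ∘ₗ a, π, hY, hc.comp ha,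
    fun y => hπ y, hπs, HasCoresolution.extension (f := p) (g := q) h ?_ ?_ ?_ hN hV⟩
  · rw [injective_iff_map_eq_zero]
    intro n hn
    obtain ⟨m, rfl⟩ := hb n
    rw [hp] at hn
    obtain ⟨x, hx⟩ := (hπ _).mp hn
    rw [← hc hx]
    exact hab.apply_apply_eq_zero x
  · intro v
    obtain ⟨y, rfl⟩ := hπs v
    rw [hq]
    constructor
    · intro hy
      obtain ⟨m, rfl⟩ := (hcd y).mp hy
      exact ⟨b m, hp m⟩
    · rintro ⟨n, hn⟩
      obtain ⟨m, rfl⟩ := hb n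
      rw [hp] at hn
      rw [← hq, ← hn, LinearMap.comp_apply, hq]
      exact hcd.apply_apply_eq_zero m
  · intro v
    obtain ⟨y, rfl⟩ := hd v
    exact ⟨π y, hq y⟩

/-- For `F` flat, `C ⊗ F` embeds in some `C ⊗ F''` which is a dual of some `Hom(C, E)`, with
cokernel again of the form `C ⊗ F'`. -/
theorem HomFlatDimLEOne.exists_tensor_embedding (h : HomFlatDimLEOne R C) (F : ModuleCat.{u} R)
    [Module.Flat R F] :
    ∃ (Y F' : ModuleCat.{u} R) (c : C ⊗[R] F →ₗ[R] Y) (d : Y →ₗ[R] C ⊗[R] F'),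
      Module.Flat R F' ∧ IsDualHom R C Y ∧ Function.Injective c ∧ Function.Exact c d ∧
      Function.Surjective d := by
  have hinj := injective_injDual (R := R) F
  have := flat_injDual h.isCoherent (InjDual R F)
  let π := (LinearMap.range (biEval R F)).mkQ
  have hπ : Function.Exact (biEval R F) π := LinearMap.exact_map_mkQ_range _
  have hπs : Function.Surjective π := Submodule.mkQ_surjective _
  exact ⟨ModuleCat.of R (C ⊗[R] InjDual R (InjDual R F)),
    ModuleCat.of R (InjDual R (InjDual R F) ⧸ LinearMap.range (biEval R F)),
    (biEval R F).lTensor C, π.lTensor C,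
    flat_of_pure hπ hπs fun J _ _ => lTensor_biEval_injective F J,
    h.isDualHom_tensor (InjDual R F), lTensor_biEval_injective F C, lTensor_exact C hπ hπs,
    LinearMap.lTensor_surjective C hπs⟩

theorem HomFlatDimLEOne.hasCoresolution_tensor (h : HomFlatDimLEOne R C) (k : ℕ)
    (F : ModuleCat.{u} R) [Module.Flat R F] :
    HasCoresolution R C k (ModuleCat.of R (C ⊗[R] F)) := by
  induction k generalizing F with
  | zero => exact h.homTorVanishes_tensor F
  | succ k ih =>
    obtain ⟨Y, F', c, d, hF', hY, hc, hcd, hd⟩ := h.exists_tensor_embedding F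
    exact ⟨Y, ModuleCat.of R (C ⊗[R] F'), c, d, hY, hc, hcd, hd, ih F'⟩

/-- The kernels in the right half are handled together: each lies in a module `C ⊗ F` with the next
kernel as quotient. Embedding `C ⊗ F` in a dual with cokernel `C ⊗ F'` allows induction on the
length through `HasCoresolution.succ_of_exact`. -/
theorem IsGCFlat.hasCoresolution (h : HomFlatDimLEOne R C) {M : ModuleCat.{u} R}
    (hM : IsGCFlat R C M) (k : ℕ) : HasCoresolution R C k M := by
  obtain ⟨X, -, hX, hex, ⟨e⟩, -⟩ := hM
  suffices H : ∀ k n, HasCoresolution R C k (ModuleCat.of R (LinearMap.ker (X.dRight n))) by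
    refine (H k 0).of_equiv h (e.trans (LinearEquiv.ofEq _ _ ?_))
    exact hex.mid_right.linearMap_ker_eq.symm
  intro k
  induction k with
  | zero =>
    intro n
    obtain ⟨F, _, ⟨e'⟩⟩ := hX n
    exact (h.homTorVanishes_tensor F).of_injective h
      (f := e'.toLinearMap ∘ₗ (LinearMap.ker (X.dRight n)).subtype)
      (e'.injective.comp (Submodule.subtype_injective _))
  | succ k ih =>
    intro n
    obtain ⟨F, _, ⟨e'⟩⟩ := hX n
    obtain ⟨Y, F', c, d, hF', hY, hc, hcd, hd⟩ := h.exists_tensor_embedding F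
    have hker := (hex.right n).linearMap_ker_eq
    have hmem : ∀ x, X.dRight n x ∈ LinearMap.ker (X.dRight (n + 1)) :=
      fun x => (hex.right n).apply_apply_eq_zero x
    refine HasCoresolution.succ_of_exact (M := X.right n) (V := ModuleCat.of R (C ⊗[R] F'))
      (N := ModuleCat.of R (LinearMap.ker (X.dRight (n + 1)))) h
      (a := (LinearMap.ker (X.dRight n)).subtype)
      (b := (X.dRight n).codRestrict _ hmem)
      (c := c ∘ₗ e'.toLinearMap) (d := d) (Submodule.subtype_injective _) ?_ ?_
      (hc.comp e'.injective) ?_ hd hY (ih (n + 1)) (h.hasCoresolution_tensor k F')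
    · rw [LinearMap.exact_iff, Submodule.range_subtype, LinearMap.ker_codRestrict]
    · rintro ⟨y, hy⟩
      obtain ⟨x, rfl⟩ := (hex.right n y).mp hy
      exact ⟨x, rfl⟩
    · intro y
      rw [hcd y]
      exact (e'.surjective.range_comp c ▸ Iff.rfl)

/-- Coresolutions pass to cokernels in `HomTorVanishes`. -/
theorem HasCoresolution.quotient {X' X D : ModuleCat.{u} R} (h : HomFlatDimLEOne R C)
    {a : X' →ₗ[R] X} {b : X →ₗ[R] D} (ha : Function.Injective a) (hab : Function.Exact a b)
    (hb : Function.Surjective b) (hD : HomTorVanishes R C D)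
    (hX' : ∀ k, HasCoresolution R C k X') (hX : ∀ k, HasCoresolution R C k X) (k : ℕ) :
    HasCoresolution R C k D := by
  cases k with
  | zero => exact hD
  | succ k =>
    -- Length `k + 2` leaves `Z` with a coresolution of length `k + 1`, as the extension below
    -- requires.
    obtain ⟨Y, Z, c, d, hY, hc, hcd, hd, hZ⟩ := hX' (k + 2)
    obtain ⟨p, hp⟩ := hY.extend ha hab hb hD c
    have hp' : ∀ x, p (a x) = c x := LinearMap.congr_fun hp
    obtain ⟨e, he⟩ := exists_factor_of_surjective (k := d ∘ₗ p) hb (fun x hx => by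
      obtain ⟨x', rfl⟩ := (hab x).mp hx
      rw [LinearMap.comp_apply, hp', hcd.apply_apply_eq_zero])
    -- The pushout of `Y ← X' → X` is an extension of `D` by `Y`, split by `p`, so it is `Y × D`; it
    -- is also an extension of `Z` by `X`.
    have hW : HasCoresolution R C (k + 1) (ModuleCat.of R (Y × D)) := by
      refine HasCoresolution.extension h (f := p.prod b)
        (g := d ∘ₗ LinearMap.fst R Y D - e ∘ₗ LinearMap.snd R Y D) ?_ ?_ ?_ (hX (k + 1)) hZ
      · rw [injective_iff_map_eq_zero]
        intro x hx
        have h1 : p x = 0 := congrArg Prod.fst hx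
        have h2 : b x = 0 := congrArg Prod.snd hx
        obtain ⟨x', rfl⟩ := (hab x).mp h2
        rw [hp'] at h1
        rw [hc (h1.trans (map_zero c).symm), map_zero]
      · rintro ⟨y, δ⟩
        obtain ⟨x, rfl⟩ := hb δ
        constructor
        · intro hy
          have h1 : d y - e (b x) = 0 := hy
          rw [he, LinearMap.comp_apply, ← map_sub] at h1
          obtain ⟨x', hx'⟩ := (hcd _).mp h1
          refine ⟨x + a x', Prod.ext ?_ ?_⟩
          · simp [hp', hx']
          · simp [hab.apply_apply_eq_zero]
        · rintro ⟨x', hx'⟩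
          have h1 : p x' = y := congrArg Prod.fst hx'
          have h2 : b x' = b x := congrArg Prod.snd hx'
          change d y - e (b x) = 0
          rw [← h1, ← h2, he, LinearMap.comp_apply, sub_self]
      · intro z
        obtain ⟨y, rfl⟩ := hd z
        exact ⟨(y, 0), by simp⟩
    obtain ⟨F, _, ⟨eY⟩⟩ := hY.exists_equiv_tensor h
    have hYk : HasCoresolution R C k Y := (h.hasCoresolution_tensor k F).of_equiv h eY
    obtain ⟨Y', Z', c', d', hY', hc', hcd', hd', hZ'⟩ := hW
    -- The summand `D` is recovered as the kernel of the projection to `Y`.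
    exact HasCoresolution.succ_of_exact (M := ModuleCat.of R (Y × D)) h
      (a := LinearMap.inr R Y D) (b := LinearMap.fst R Y D) LinearMap.inr_injective
      (Function.Exact.inr_fst) LinearMap.fst_surjective hc' hcd' hd' hY' hYk hZ'

end Coresolution

/-! ### Descent along a finite `G_C`-flat resolution -/

section Resolution

variable {R : Type u} [CommRing R] {C : Type u} [AddCommGroup C] [Module R C]

/-- The tail of a resolution, resolving the first syzygy. -/
noncomputable def LeftResolution.tail {M : Type u} [AddCommGroup M] [Module R M]
    (X : LeftResolution R M) : LeftResolution R (LinearMap.ker X.ε) where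
  obj n := X.obj (n + 1)
  d n := X.d (n + 1)
  ε := (X.d 0).codRestrict (LinearMap.ker X.ε)
    fun x => LinearMap.mem_ker.mpr (X.exact_ε.apply_apply_eq_zero x)
  exact_d n := X.exact_d (n + 1)
  exact_ε := by
    rw [LinearMap.exact_iff]
    refine (LinearMap.ker_codRestrict _ _ _).trans ?_
    exact (X.exact_d 0).linearMap_ker_eq
  surjective_ε := by
    rintro ⟨y, hy⟩
    obtain ⟨x, rfl⟩ := (X.exact_ε y).mp hy
    exact ⟨x, rfl⟩

/-- Induction on the length of the resolution: the first syzygy is a submodule of a `G_C`-flat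
module, hence in `HomTorVanishes`, and has a shorter resolution. -/
theorem hasCoresolution_of_resolution (h : HomFlatDimLEOne R C) (n : ℕ) (D : ModuleCat.{u} R)
    (hD : HomTorVanishes R C D) (X : LeftResolution R D) (hX : ∀ m, IsGCFlat R C (X.obj m))
    (hn : ∀ m, n < m → Subsingleton (X.obj m)) (k : ℕ) : HasCoresolution R C k D := by
  induction n generalizing D k with
  | zero =>
    have hinj : Function.Injective X.ε := by
      rw [injective_iff_map_eq_zero]
      intro x hx
      obtain ⟨y, rfl⟩ := (X.exact_ε x).mp hx
      have := hn 1 one_pos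
      rw [Subsingleton.elim y 0, map_zero]
    exact ((hX 0).hasCoresolution h k).of_equiv h
      (LinearEquiv.ofBijective X.ε ⟨hinj, X.surjective_ε⟩).symm
  | succ n ih =>
    have hX₀ := (hX 0).hasCoresolution h
    have hinj : Function.Injective (LinearMap.ker X.ε).subtype := Submodule.subtype_injective _
    refine HasCoresolution.quotient (X' := ModuleCat.of R (LinearMap.ker X.ε)) h hinj
      (LinearMap.exact_subtype_ker_map X.ε) X.surjective_ε hD ?_ hX₀ k
    exact ih (ModuleCat.of R (LinearMap.ker X.ε))
      (((hX₀ 0).homTorVanishes h).of_injective h hinj) X.tail (fun m => hX (m + 1))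
      (fun m hm => hn (m + 1) (by lia))

theorem hasCoresolution_of_gcWeakGlobalDim_lt_top (h : HomFlatDimLEOne R C)
    (hfin : gcWeakGlobalDim R C < ⊤) (D : ModuleCat.{u} R) (hD : HomTorVanishes R C D) (k : ℕ) :
    HasCoresolution R C k D := by
  have h1 : gcFlatDim R C D < ⊤ :=
    (le_iSup (fun M : ModuleCat.{u} R => gcFlatDim R C M) D).trans_lt hfin
  simp only [gcFlatDim, relProjDim, iInf_lt_iff] at h1
  obtain ⟨X, hX, hlen⟩ := h1
  obtain ⟨n, hn⟩ := ENat.ne_top_iff_exists.mp hlen.ne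
  refine hasCoresolution_of_resolution h n D hD X hX (fun m hm => ?_) k
  by_contra hm'
  rw [not_subsingleton_iff_nontrivial] at hm'
  have h2 : (m : ℕ∞) ≤ X.length := le_iSup₂ (f := fun (n : ℕ) (_ : Nontrivial (X.obj n)) =>
    (n : ℕ∞)) m hm'
  rw [← hn, Nat.cast_le] at h2
  lia

end Resolution

/-! ### Splicing the two-sided sequence -/

section Construction

variable {R : Type u} [CommRing R] {C : Type u} [AddCommGroup C] [Module R C]

theorem exact_splice {B D B' D' B'' : Type*} [AddCommGroup B] [Module R B] [AddCommGroup D]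
    [Module R D] [AddCommGroup B'] [Module R B'] [AddCommGroup D'] [Module R D']
    [AddCommGroup B''] [Module R B''] {p : B →ₗ[R] D} {i : D →ₗ[R] B'} {p' : B' →ₗ[R] D'}
    {i' : D' →ₗ[R] B''} (hp : Function.Surjective p) (h : Function.Exact i p')
    (hi' : Function.Injective i') : Function.Exact (i ∘ₗ p) (i' ∘ₗ p') := by
  intro y
  rw [LinearMap.comp_apply, map_eq_zero_iff _ hi', h y, LinearMap.coe_comp,
    hp.range_comp]

theorem exact_lTensor_splice {B D B' D' B'' J : Type u} [AddCommGroup B] [Module R B]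
    [AddCommGroup D] [Module R D] [AddCommGroup B'] [Module R B'] [AddCommGroup D'] [Module R D']
    [AddCommGroup B''] [Module R B''] [AddCommGroup J] [Module R J] {p : B →ₗ[R] D}
    {i : D →ₗ[R] B'} {p' : B' →ₗ[R] D'} {i' : D' →ₗ[R] B''} (hp : Function.Surjective p)
    (h : Function.Exact i p') (hp' : Function.Surjective p')
    (hi' : Function.Injective (i'.lTensor J)) :
    Function.Exact ((i ∘ₗ p).lTensor J) ((i' ∘ₗ p').lTensor J) := by
  rw [LinearMap.lTensor_comp, LinearMap.lTensor_comp]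
  exact exact_splice (LinearMap.lTensor_surjective J hp) (lTensor_exact J h hp') hi'

variable (R) in
/-- The iterated syzygies of a module in canonical free covers. -/
noncomputable def syzygy (D : ModuleCat.{u} R) : ℕ → ModuleCat.{u} R
  | 0 => D
  | n + 1 => freeKer R (syzygy D n)

variable (R) in
/-- The inclusion of a syzygy in the canonical free cover of the previous one. -/
noncomputable def syzygyIncl (D : ModuleCat.{u} R) (n : ℕ) :
    syzygy R D (n + 1) →ₗ[R] freeOn R (syzygy R D n) :=
  freeKerIncl R (syzygy R D n)

theorem syzygyIncl_injective (D : ModuleCat.{u} R) (n : ℕ) :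
    Function.Injective (syzygyIncl R D n) :=
  freeKerIncl_injective _

theorem exact_syzygyIncl (D : ModuleCat.{u} R) (n : ℕ) :
    Function.Exact (syzygyIncl R D n) (freeCover R (syzygy R D n)) :=
  exact_freeCover _

/-- A module with an infinite coresolution by modules `C ⊗ F`, with all cosyzygies in
`HomTorVanishes`, is `G_C`-flat. -/
theorem isGCFlat_of_coresolution (h : HomFlatDimLEOne R C) (D F : ℕ → ModuleCat.{u} R)
    (hD : ∀ n, HomTorVanishes R C (D n)) (hF : ∀ n, Module.Flat R (F n))
    (f : ∀ n, D n →ₗ[R] C ⊗[R] F n) (g : ∀ n, C ⊗[R] F n →ₗ[R] D (n + 1))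
    (hf : ∀ n, Function.Injective (f n)) (hfg : ∀ n, Function.Exact (f n) (g n))
    (hg : ∀ n, Function.Surjective (g n)) : IsGCFlat R C (D 0) := by
  -- Positive syzygies are submodules of free modules. With the vanishing on the cosyzygies, this
  -- makes every short exact piece stay exact after tensoring with `Hom(C, E)`.
  have hS : ∀ n, HomTorVanishes R C (syzygy R (D 0) n) := fun n => by
    cases n with
    | zero => exact hD 0
    | succ n =>
      exact (HomTorVanishes.of_flat (freeOn R (syzygy R (D 0) n))).of_injective h
        (syzygyIncl_injective _ _)
  let X : TwoSidedSeq R :=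
    { left n := freeOn R (syzygy R (D 0) n)
      right n := ModuleCat.of R (C ⊗[R] F n)
      dLeft n := syzygyIncl R (D 0) n ∘ₗ freeCover R (syzygy R (D 0) (n + 1))
      mid := f 0 ∘ₗ freeCover R (D 0)
      dRight n := f (n + 1) ∘ₗ g n }
  have hfT : ∀ (E : ModuleCat.{u} R) [Module.Injective R E] (n : ℕ),
      Function.Injective ((f n).lTensor (C →ₗ[R] E)) := fun E _ n =>
    (hD (n + 1)).lTensor_injective (hf n) (hfg n) (hg n) E
  have hST : ∀ (E : ModuleCat.{u} R) [Module.Injective R E] (n : ℕ),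
      Function.Injective ((syzygyIncl R (D 0) n).lTensor (C →ₗ[R] E)) :=
    fun E _ n => (hS n).lTensor_injective (syzygyIncl_injective _ _) (exact_syzygyIncl _ _)
      (freeCover_surjective _) E
  refine ⟨X, fun n => ?_, fun n => ⟨F n, hF n, ⟨LinearEquiv.refl R _⟩⟩,
    ⟨fun n => ?_, ?_, ?_, fun n => ?_⟩, ⟨?_⟩, fun E hE => ⟨fun n => ?_, ?_, ?_, fun n => ?_⟩⟩
  · exact inferInstanceAs (Module.Flat R (freeOn R (syzygy R (D 0) n)))
  · exact exact_splice (freeCover_surjective _) (exact_syzygyIncl _ _) (syzygyIncl_injective _ _)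
  · exact exact_splice (freeCover_surjective _) (exact_syzygyIncl (D 0) 0) (hf 0)
  · exact exact_splice (freeCover_surjective (D 0)) (hfg 0) (hf 1)
  · exact exact_splice (hg n) (hfg (n + 1)) (hf (n + 2))
  · refine (LinearEquiv.ofInjective (f 0) (hf 0)).trans (LinearEquiv.ofEq _ _ ?_)
    exact (LinearMap.range_comp_of_range_eq_top _
      (LinearMap.range_eq_top.mpr (freeCover_surjective (D 0)))).symm
  · exact exact_lTensor_splice (freeCover_surjective _) (exact_syzygyIncl _ _)
      (freeCover_surjective _) (hST E n)
  · exact exact_lTensor_splice (freeCover_surjective _) (exact_syzygyIncl (D 0) 0)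
      (freeCover_surjective _) (hfT E 0)
  · exact exact_lTensor_splice (freeCover_surjective (D 0)) (hfg 0) (hg 0) (hfT E 1)
  · exact exact_lTensor_splice (hg n) (hfg (n + 1)) (hg (n + 1)) (hfT E (n + 2))

theorem HomTorVanishes.exists_embedding (h : HomFlatDimLEOne R C)
    (hfin : gcWeakGlobalDim R C < ⊤) (D : ModuleCat.{u} R) (hD : HomTorVanishes R C D) :
    ∃ (F Z : ModuleCat.{u} R) (f : D →ₗ[R] C ⊗[R] F) (g : C ⊗[R] F →ₗ[R] Z),
      HomTorVanishes R C Z ∧ Module.Flat R F ∧ Function.Injective f ∧ Function.Exact f g ∧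
      Function.Surjective g := by
  obtain ⟨Y, Z, f, g, hY, hf, hfg, hg, hZ⟩ :=
    -- Length one suffices: the cokernel is again in `HomTorVanishes`, so the step can be repeated
    -- indefinitely.
    hasCoresolution_of_gcWeakGlobalDim_lt_top h hfin D hD 1
  obtain ⟨F, hF, ⟨e⟩⟩ := hY.exists_equiv_tensor h
  refine ⟨F, Z, e.toLinearMap ∘ₗ f, g ∘ₗ e.symm.toLinearMap, hZ, hF, e.injective.comp hf,
    fun y => ?_, hg.comp e.symm.surjective⟩
  obtain ⟨y, rfl⟩ := e.surjective y
  simp [hfg y]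

theorem HomTorVanishes.isGCFlat (h : HomFlatDimLEOne R C) (hfin : gcWeakGlobalDim R C < ⊤)
    (D : ModuleCat.{u} R) (hD : HomTorVanishes R C D) : IsGCFlat R C D := by
  choose F Z f g hZ hF hf hfg hg using fun D : {D : ModuleCat.{u} R // HomTorVanishes R C D} =>
    HomTorVanishes.exists_embedding h hfin D.1 D.2
  let S : ℕ → {D : ModuleCat.{u} R // HomTorVanishes R C D} :=
    fun n => Nat.rec ⟨D, hD⟩ (fun _ D' => ⟨Z D', hZ D'⟩) n
  exact isGCFlat_of_coresolution h (fun n => (S n).1) (fun n => F (S n)) (fun n => (S n).2)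
    (fun n => hF (S n)) (fun n => f (S n)) (fun n => g (S n)) (fun n => hf (S n))
    (fun n => hfg (S n)) (fun n => hg (S n))

end Construction

end GCModules

theorem theorem3p10 (R : Type u) [CommRing R] (C : Type u) [AddCommGroup C] [Module R C]
    (hC : GCModules.IsSemidualizing R C)
    (hfin : GCModules.gcWeakGlobalDim R C < ⊤)
    (hsub : ∀ G : ModuleCat.{u} R, GCModules.IsGCProjective R C G →
      ∀ N : Submodule R G, N.FG → GCModules.IsGCProjective R C N) :
    GCModules.IsGCSemihereditary R C := by
  have hsub' : GCModules.FGSubmodulesGCProjective R C := hsub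
  have h := hsub'.homFlatDimLEOne hC
  refine ⟨h.isCoherent, fun F _ N => ?_⟩
  exact GCModules.HomTorVanishes.isGCFlat h hfin (ModuleCat.of R N)
    ((GCModules.HomTorVanishes.of_flat F).of_injective h (Submodule.subtype_injective N))
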